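/- Let $k\ge 0$, let $\theta_1\ge\dots\ge\theta_k>0$, and let $r_1,\dots,r_k:[0,1]\to\mathbb R$ be Lipschitz functions that are orthonormal in $L^2[0,1]$ and such that $$f(x,y):=\sum_{i=1}^k\theta_i r_i(x)r_i(y)\ge 0\qquad\text{for all }(x,y)\in[0,1]^2 .$$ Let $(\varepsilon_N)_{N\ge1}$ be a real sequence with $0<\varepsilon_N\le\bigl[\sup_{[0,1]^2}f\bigr]^{-1}$ for all $N\ge1$, such that $\lim_{N\to\infty}(\log N)^{\xi}/(N\varepsilon_N)=0$ for some $\xi>8$ and $\lim_{N\to\infty}\varepsilon_N=\varepsilon_\infty$ for some $\varepsilon_\infty\ge0$. For each $N\ge1$ let $A=A_N$ be the adjacency matrix of the inhomogeneous Erdős–Rényi random graph on $\{1,\dots,N\}$ with self-loops allowed, that is, $A_N$ is a random symmetric $N\times N$ matrix whose entries $A_N(a,b)$, $1\le a\le b\le N$, are independent with $A_N(a,b)\sim\mathrm{Bernoulli}\bigl(\varepsilon_N f(a/N,b/N)\bigr)$. Put $W=W_N=A_N-\mathrm E(A_N)$ (entrywise expectation) and let $e_j=e_j^{(N)}\in\mathbb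 R^N$ be the vector with entries $e_j(a)=N^{-1/2}r_j(a/N)$, $1\le a\le N$. For a real symmetric matrix $M$ let $\lambda_1(M)\ge\lambda_2(M)\ge\cdots$ be its eigenvalues with multiplicity. Let $$\mathcal I=\{1\le i\le k:\theta_{i-1}>\theta_i>\theta_{i+1}\},\qquad \theta_0=\infty,\quad\theta_{k+1}=-\infty .$$ Then for every $i\in\mathcal I$ the random variable $\lambda_i(A_N)$ is integrable, and as $N\to\infty$ $$\mathrm E\bigl[\lambda_i(A_N)\bigr]=\lambda_i(B_N)+O\bigl(\sqrt{\varepsilon_N}+(N\varepsilon_N)^{-1}\bigr),$$ where $B_N$ is the deterministic symmetric $k\times k$ matrix (depending on $N$ and $i$) with entries $$B_N(j,l)=\sqrt{\theta_j\theta_l}\,N\varepsilon_N\,e_j'e_l+\theta_i^{-2}\sqrt{\theta_j\theta_l}\,(N\varepsilon_N)^{-1}\,\mathrm E\bigl(e_j'W^2e_l\bigr),\qquad 1\le j,l\le k .$$ (For the finitely many $N<i$, where $\lambda_i(A_N)$ does not exist, it is read as $0$.) -/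

import Mathlib

open MeasureTheory ProbabilityTheory Filter Asymptotics Topology

namespace InhomER

noncomputable section

/-- The spectral decomposition `f(x, y) = ∑ᵢ θᵢ rᵢ(x) rᵢ(y) ≥ 0` on `[0,1]²` of a kernel whose
integral operator is non-negative definite of rank `k`, with positive eigenvalues listed in
decreasing order and orthonormal eigenfunctions in `L²[0,1]`. -/
structure IsSpectralDecomposition {k : ℕ} (f : ℝ → ℝ → ℝ) (θ : Fin k → ℝ)
    (r : Fin k → ℝ → ℝ) : Prop where
  antitone : Antitone θ
  pos : ∀ i, 0 < θ i
  memLp : ∀ i, MemLp (r i) 2 (volume.restrict (Set.Icc 0 1))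
  orthonormal : ∀ i j, ∫ x in Set.Icc (0 : ℝ) 1, r i x * r j x = if i = j then 1 else 0
  decomp : ∀ x ∈ Set.Icc (0 : ℝ) 1, ∀ y ∈ Set.Icc (0 : ℝ) 1,
    f x y = ∑ i, θ i * r i x * r i y
  nonneg : ∀ x ∈ Set.Icc (0 : ℝ) 1, ∀ y ∈ Set.Icc (0 : ℝ) 1, 0 ≤ f x y

/-- Assumption F2: every eigenfunction is Lipschitz on `[0,1]`. -/
def AssumptionF2 {k : ℕ} (r : Fin k → ℝ → ℝ) : Prop :=
  ∀ i, ∃ K : ℝ, ∀ x ∈ Set.Icc (0 : ℝ) 1, ∀ y ∈ Set.Icc (0 : ℝ) 1, |r i x - r i y| ≤ K * |x - y|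

/-- Standing assumption on the sparsity: `0 < ε_N ≤ (sup f)⁻¹` for all `N ≥ 1`, the supremum
being over `[0,1]²`. -/
def IsSparsitySeq (f : ℝ → ℝ → ℝ) (ε : ℕ → ℝ) : Prop :=
  ∀ N, 1 ≤ N → 0 < ε N ∧
    ε N ≤ (sSup (Function.uncurry f '' (Set.Icc (0 : ℝ) 1 ×ˢ Set.Icc (0 : ℝ) 1)))⁻¹

/-- Assumption E1: `(log N)^ξ ≪ N ε_N` for some `ξ > 8`, and `ε_N` converges to some `ε_∞ ≥ 0`. -/
def AssumptionE1 (ε : ℕ → ℝ) : Prop :=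
  (∃ ξ : ℝ, 8 < ξ ∧ Tendsto (fun N : ℕ => 1 / (N * ε N) * Real.log N ^ ξ) atTop (𝓝 0)) ∧
  ∃ εlim : ℝ, 0 ≤ εlim ∧ Tendsto ε atTop (𝓝 εlim)

/-- `X` is a Bernoulli random variable with success probability `p` (so that `0 ≤ p ≤ 1`). -/
def IsBernoulli {Ω : Type*} [MeasurableSpace Ω] (X : Ω → ℝ) (p : ℝ) (P : Measure Ω) : Prop :=
  ∃ q : unitInterval, (q : ℝ) = p ∧ HasLaw X (bernoulliMeasure 1 0 q) P

/-- `A` is the adjacency matrix of the inhomogeneous Erdős–Rényi graph on `N` vertices with edge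
probabilities `ε f(a/N, b/N)`, self-loops allowed. The vertex `a : Fin N` stands for `a + 1` in
`{1, …, N}`. -/
structure IsAdjacency {Ω : Type*} [MeasurableSpace Ω] (P : Measure Ω) (N : ℕ) (ε : ℝ)
    (f : ℝ → ℝ → ℝ) (A : Ω → Matrix (Fin N) (Fin N) ℝ) : Prop where
  symm : ∀ ω, (A ω).IsSymm
  bernoulli : ∀ a b : Fin N, a ≤ b →
    IsBernoulli (fun ω => A ω a b) (ε * f (((a : ℝ) + 1) / N) (((b : ℝ) + 1) / N)) P
  indep : iIndepFun (fun (p : {p : Fin N × Fin N // p.1 ≤ p.2}) ω => A ω p.1.1 p.1.2) P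

/-- The indices of isolated eigenvalues: `θ_{i-1} > θ_i > θ_{i+1}`, where `θ_0 = ∞` and
`θ_{k+1} = -∞`. -/
def isolated {k : ℕ} (θ : Fin k → ℝ) : Set (Fin k) :=
  {i | (∀ j : Fin k, (j : ℕ) + 1 = i → θ i < θ j) ∧ (∀ j : Fin k, (j : ℕ) = i + 1 → θ j < θ i)}

open Classical in
/-- The eigenvalues of an `n × n` real symmetric matrix in decreasing order with multiplicity:
`eig M i` is the `(i+1)`-st largest one. (It is `0` if `M` is not symmetric or if `n ≤ i`.) -/
def eig {n : ℕ} (M : Matrix (Fin n) (Fin n) ℝ) (i : ℕ) : ℝ :=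
  if h : M.IsHermitian ∧ i < n then
    h.1.eigenvalues₀ ⟨i, h.2.trans_eq (Fintype.card_fin n).symm⟩
  else 0

/-- The discretised eigenfunction `N^{-1/2} (g(1/N), g(2/N), …, g(1))`. -/
def discretize (N : ℕ) (g : ℝ → ℝ) : Fin N → ℝ :=
  fun a => (Real.sqrt N)⁻¹ * g (((a : ℝ) + 1) / N)

/-- The centred matrix `W = A - E(A)`, with the entrywise expectation. -/
def centred {Ω : Type*} [MeasurableSpace Ω] (P : Measure Ω) {N : ℕ}
    (A : Ω → Matrix (Fin N) (Fin N) ℝ) (ω : Ω) : Matrix (Fin N) (Fin N) ℝ :=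
  A ω - Matrix.of fun a b => ∫ ω', A ω' a b ∂P

/-- The `k × k` matrix with entries
`√(θ_j θ_l) N ε e_j' e_l + θ_i⁻² √(θ_j θ_l) (N ε)⁻¹ E(e_j' W² e_l)`. -/
def matB {Ω : Type*} [MeasurableSpace Ω] (P : Measure Ω) {k N : ℕ} (ε : ℝ) (θ : Fin k → ℝ)
    (r : Fin k → ℝ → ℝ) (A : Ω → Matrix (Fin N) (Fin N) ℝ) (i : Fin k) :
    Matrix (Fin k) (Fin k) ℝ :=
  Matrix.of fun j l =>
    Real.sqrt (θ j * θ l) * (N * ε) * (discretize N (r j) ⬝ᵥ discretize N (r l)) +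
      (θ i ^ 2)⁻¹ * Real.sqrt (θ j * θ l) * (N * ε)⁻¹ *
        ∫ ω, discretize N (r j) ⬝ᵥ ((centred P A ω ^ 2).mulVec (discretize N (r l))) ∂P

end

end InhomER

/-! Write s = N ε_N. The mean of A is exactly s ∑ θ_j e_j e_j', and Riemann sums of Lipschitz
functions make the e_j orthonormal up to O(1/N). If ‖W‖ is at most a small multiple of s, then μ =
λ_i(A) is close to s θ_i, the matrix S = (1 - W/μ)⁻¹ exists, and the equation A x = μ x collapses to
k dimensions: μ is an eigenvalue of the matrix K with entries √(θ_j θ_l) s e_j' S e_l. Since K is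
near diag(s θ), the gap around θ_i forces μ to be its i-th eigenvalue.

Expanding S in powers of W/μ turns K into B up to five errors: e_j'We_l, the fluctuation of
e_j'W²e_l, e_j'W³e_l, a remainder controlled by e_j'W⁴e_j + e_l'W⁴e_l, and the cost of replacing μ⁻²
by (s θ_i)⁻². The last is O(|μ - s θ_i| / s), and a cruder use of the same expansion bounds it.
Weyl's inequality passes from matrices to eigenvalues. This deterministic part is
`exists_abs_eig_sub_eig_le`.

The expected errors come from counting walks. The expectation of a product of entries along a walk
vanishes unless each edge is repeated, and is otherwise at most δ to the number of distinct edges,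
where δ bounds the variances. Weighting each distinct edge by q = δ t, with t ≤ 1 free, reduces
everything to sums of q^(distinct edges), which `sum_walk_le` and `sum_walk_meet_le` bound step by
step: a step either uses a fresh edge, at cost q, or leads to a visited vertex. For fixed powers t =
1/(N δ) gives the means and variances behind `integral_entryError_le`, hence the rate √ε + 1/s. For
the power 2m with m ≈ log N, a larger t gives `integral_trace_div_le`.

Where ‖W‖ may be large, the trivial O(N²) bound on the eigenvalue difference is multiplied by
tr(W^{2m})/b^{2m} ≥ 1 with b = c s. Its expectation is at most N⁻³, so this contributes O(1/N) =
O(ε/s). -/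

namespace InhomER

/-! ### Counting walks by the number of distinct edges -/

section Walks

variable {V : Type*}

/-- The edges traversed by the walk that starts at `a` and visits the vertices of a list. -/
def walkEdges : V → List V → List (Sym2 V)
  | _, [] => []
  | a, b :: l => s(a, b) :: walkEdges b l

@[simp] lemma walkEdges_nil (a : V) : walkEdges a [] = [] := rfl

@[simp] lemma walkEdges_cons (a b : V) (l : List V) :
    walkEdges a (b :: l) = s(a, b) :: walkEdges b l := rfl

@[simp] lemma length_walkEdges (a : V) (l : List V) : (walkEdges a l).length = l.length := by
  induction l generalizing a with
  | nil => rfl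
  | cons b l ih => simp [ih]

lemma mem_of_mem_walkEdges {a : V} {l : List V} {e : Sym2 V} (he : e ∈ walkEdges a l) {x : V}
    (hx : x ∈ e) : x ∈ a :: l := by
  induction l generalizing a with
  | nil => simp at he
  | cons b l ih =>
    rw [walkEdges_cons, List.mem_cons] at he
    rcases he with rfl | he
    · rw [Sym2.mem_iff] at hx
      rcases hx with rfl | rfl <;> simp
    · exact List.mem_cons_of_mem _ (ih he)

lemma sum_fin_succ_fun [Fintype V] {M : Type*} [AddCommMonoid M] (n : ℕ) (g : (Fin (n + 1) → V) → M) :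
    ∑ w, g w = ∑ b, ∑ w : Fin n → V, g (Fin.cons b w) := by
  rw [← (Fin.consEquiv fun _ : Fin (n + 1) => V).sum_comp, Fintype.sum_prod_type]
  rfl

variable [Fintype V] [DecidableEq V]

/-- One step of a walk: the new edge either is fresh, or leads to a visited vertex. -/
lemma sum_pow_card_insert_le {q : ℝ} (hq : 0 ≤ q) (F : Finset (Sym2 V)) (T : Finset V)
    (hFT : ∀ e ∈ F, ∀ x ∈ e, x ∈ T) (b : V) :
    ∑ a, q ^ (insert s(a, b) F).card ≤ q ^ F.card * (Fintype.card V * q + T.card) := by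
  have h : ∀ a, q ^ (insert s(a, b) F).card ≤ q ^ F.card * (q + if a ∈ T then 1 else 0) := by
    intro a
    by_cases ha : s(a, b) ∈ F
    · rw [Finset.insert_eq_of_mem ha, if_pos (hFT _ ha a (Sym2.mem_mk_left a b))]
      nlinarith [pow_nonneg hq F.card]
    · rw [Finset.card_insert_of_notMem ha, pow_succ]
      gcongr
      split_ifs <;> simp
  calc _ ≤ ∑ a, q ^ F.card * (q + if a ∈ T then 1 else 0) := Finset.sum_le_sum fun a _ => h a
    _ = _ := by
      rw [← Finset.mul_sum, Finset.sum_add_distrib]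
      simp

/-- Walks of length `n` from a visited vertex. -/
lemma sum_walk_le {q D : ℝ} (hq : 0 ≤ q) (n : ℕ) (F : Finset (Sym2 V)) (S : Finset V)
    (hFS : ∀ e ∈ F, ∀ x ∈ e, x ∈ S) (a : V) (ha : a ∈ S) (hD : (S.card : ℝ) + n ≤ D) :
    ∑ w : Fin n → V, q ^ (F ∪ (walkEdges a (List.ofFn w)).toFinset).card ≤
      q ^ F.card * (Fintype.card V * q + D) ^ n := by
  induction n generalizing F S a with
  | zero => simp
  | succ n ih =>
    rw [sum_fin_succ_fun]
    push_cast at hD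
    have hD0 : 0 ≤ Fintype.card V * q + D := by
      have h0 : 0 ≤ Fintype.card V * q := by positivity
      linarith [Nat.cast_nonneg (α := ℝ) n, Nat.cast_nonneg (α := ℝ) S.card]
    have h1 : ∀ b, ∑ w : Fin n → V,
        q ^ (F ∪ (walkEdges a (List.ofFn (Fin.cons b w : Fin (n + 1) → V))).toFinset).card ≤
        q ^ (insert s(b, a) F).card * (Fintype.card V * q + D) ^ n := by
      intro b
      -- One step adds at most one visited vertex and leaves one step fewer, so the same `D` serves
      -- throughout the induction.
      have := ih (insert s(b, a) F) (insert b S) (by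
        intro e he x hx
        rw [Finset.mem_insert] at he
        rcases he with rfl | he
        · rw [Sym2.mem_iff] at hx
          rcases hx with rfl | rfl <;> simp [ha]
        · exact Finset.mem_insert_of_mem (hFS e he x hx)) b (Finset.mem_insert_self _ _) (by
          have : ((insert b S).card : ℝ) ≤ S.card + 1 := by
            exact_mod_cast Finset.card_insert_le b S
          linarith)
      refine le_trans (le_of_eq ?_) this
      refine Finset.sum_congr rfl fun w _ => ?_
      simp [List.ofFn_succ, Sym2.eq_swap]
    calc _ ≤ ∑ b, q ^ (insert s(b, a) F).card * (Fintype.card V * q + D) ^ n :=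
          Finset.sum_le_sum fun b _ => h1 b
      _ ≤ (q ^ F.card * (Fintype.card V * q + S.card)) * (Fintype.card V * q + D) ^ n := by
          rw [← Finset.sum_mul]
          gcongr
          exact sum_pow_card_insert_le hq F S hFS a
      _ ≤ (q ^ F.card * (Fintype.card V * q + D)) * (Fintype.card V * q + D) ^ n := by
          gcongr
          linarith [Nat.cast_nonneg (α := ℝ) n]
      _ = _ := by ring

open Classical in
/-- Walks of length `n` that meet a given set of visited vertices. -/
lemma sum_walk_meet_le {q D : ℝ} (hq : 0 ≤ q) (n : ℕ) (F : Finset (Sym2 V)) (S : Finset V)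
    (hFS : ∀ e ∈ F, ∀ x ∈ e, x ∈ S) (hD : (S.card : ℝ) + n ≤ D) :
    ∑ a, ∑ w : Fin n → V, (if ∃ x ∈ a :: List.ofFn w, x ∈ S then
        q ^ (F ∪ (walkEdges a (List.ofFn w)).toFinset).card else 0) ≤
      q ^ F.card * ((n + 1) * S.card * (Fintype.card V * q + D) ^ n) := by
  induction n with
  | zero =>
    simp
    rw [mul_comm]
  | succ n ih =>
    push_cast at hD
    specialize ih (by linarith)
    have hn := Nat.cast_nonneg (α := ℝ) n
    have hc := Nat.cast_nonneg (α := ℝ) S.card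
    have hD0 : 0 ≤ Fintype.card V * q + D := by
      have : 0 ≤ Fintype.card V * q := by positivity
      linarith
    -- Either the walk starts in `S`, and `sum_walk_le` applies, or its tail already meets `S`. Each
    -- unit of the factor `n + 1` comes from one round of this dichotomy.
    have h1 : ∀ a, ∑ w : Fin (n + 1) → V, (if ∃ x ∈ a :: List.ofFn w, x ∈ S then
        q ^ (F ∪ (walkEdges a (List.ofFn w)).toFinset).card else 0) ≤
        (if a ∈ S then q ^ F.card * (Fintype.card V * q + D) ^ (n + 1) else 0) +
        ∑ b, ∑ w : Fin n → V, (if ∃ x ∈ b :: List.ofFn w, x ∈ S then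
          q ^ (insert s(a, b) (F ∪ (walkEdges b (List.ofFn w)).toFinset)).card else 0) := by
      intro a
      by_cases ha : a ∈ S
      · rw [if_pos ha]
        have h2 := sum_walk_le hq (n + 1) F S hFS a ha (D := D) (by push_cast; linarith)
        have h3 : 0 ≤ ∑ b, ∑ w : Fin n → V, (if ∃ x ∈ b :: List.ofFn w, x ∈ S then
          q ^ (insert s(a, b) (F ∪ (walkEdges b (List.ofFn w)).toFinset)).card else 0) := by
          positivity
        refine le_trans ?_ (add_le_add h2 h3)
        rw [add_zero]
        refine Finset.sum_le_sum fun w _ => ?_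
        split_ifs
        · exact le_rfl
        · positivity
      · rw [if_neg ha, zero_add, sum_fin_succ_fun]
        refine le_of_eq (Finset.sum_congr rfl fun b _ => Finset.sum_congr rfl fun w _ => ?_)
        simp [List.ofFn_succ, ha]
    -- For a fixed tail the starting vertex is summed as a backward step, with the vertices of the
    -- tail counted as visited.
    have h2 : ∀ b, ∀ w : Fin n → V, ∑ a, q ^ (insert s(a, b)
        (F ∪ (walkEdges b (List.ofFn w)).toFinset)).card ≤
        q ^ (F ∪ (walkEdges b (List.ofFn w)).toFinset).card * (Fintype.card V * q + D) := by
      intro b w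
      refine (sum_pow_card_insert_le hq _ (S ∪ (b :: List.ofFn w).toFinset) ?_ b).trans ?_
      · intro e he x hx
        rw [Finset.mem_union] at he ⊢
        rcases he with he | he
        · exact Or.inl (hFS e he x hx)
        · right
          rw [List.mem_toFinset] at he ⊢
          exact mem_of_mem_walkEdges he hx
      · gcongr
        have h4 : (S ∪ (b :: List.ofFn w).toFinset).card ≤ S.card + (n + 1) := by
          refine (Finset.card_union_le _ _).trans ?_
          gcongr
          refine (List.toFinset_card_le _).trans ?_
          simp
        have h5 : ((S ∪ (b :: List.ofFn w).toFinset).card : ℝ) ≤ S.card + (n + 1) := by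
          exact_mod_cast h4
        linarith
    calc _ ≤ ∑ a, ((if a ∈ S then q ^ F.card * (Fintype.card V * q + D) ^ (n + 1) else 0) +
        ∑ b, ∑ w : Fin n → V, (if ∃ x ∈ b :: List.ofFn w, x ∈ S then
          q ^ (insert s(a, b) (F ∪ (walkEdges b (List.ofFn w)).toFinset)).card else 0)) :=
          Finset.sum_le_sum fun a _ => h1 a
      _ = S.card * (q ^ F.card * (Fintype.card V * q + D) ^ (n + 1)) +
        ∑ b, ∑ w : Fin n → V, (if ∃ x ∈ b :: List.ofFn w, x ∈ S then
          ∑ a, q ^ (insert s(a, b) (F ∪ (walkEdges b (List.ofFn w)).toFinset)).card else 0) := by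
          rw [Finset.sum_add_distrib]
          congr 1
          · simp
          · rw [Finset.sum_comm]
            refine Finset.sum_congr rfl fun b _ => ?_
            rw [Finset.sum_comm]
            refine Finset.sum_congr rfl fun w _ => ?_
            split_ifs <;> simp
      _ ≤ S.card * (q ^ F.card * (Fintype.card V * q + D) ^ (n + 1)) +
        ∑ b, ∑ w : Fin n → V, (if ∃ x ∈ b :: List.ofFn w, x ∈ S then
          q ^ (F ∪ (walkEdges b (List.ofFn w)).toFinset).card else 0) *
            (Fintype.card V * q + D) := by
          gcongr with b _ w _
          split_ifs
          · exact h2 b w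
          · simp
      _ ≤ S.card * (q ^ F.card * (Fintype.card V * q + D) ^ (n + 1)) +
        (q ^ F.card * ((n + 1) * S.card * (Fintype.card V * q + D) ^ n)) *
            (Fintype.card V * q + D) := by
          simp_rw [← Finset.sum_mul]
          gcongr
      _ = _ := by push_cast; ring

end Walks

/-! ### Moments of random symmetric matrices with independent centred entries -/

section Moments

variable {V Ω : Type*}

/-- The symmetric matrix with the given entries. -/
def symMatrix (X : Sym2 V → Ω → ℝ) (ω : Ω) : Matrix V V ℝ :=
  Matrix.of fun a b => X s(a, b) ω

lemma symMatrix_apply (X : Sym2 V → Ω → ℝ) (ω : Ω) (a b : V) :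
    symMatrix X ω a b = X s(a, b) ω := rfl

lemma symMatrix_isSymm (X : Sym2 V → Ω → ℝ) (ω : Ω) : (symMatrix X ω).IsSymm := by
  ext a b
  simp [symMatrix, Sym2.eq_swap]

/-- The product of the entries along a list of edges. -/
def edgeProd (X : Sym2 V → Ω → ℝ) (L : List (Sym2 V)) (ω : Ω) : ℝ :=
  (L.map fun e => X e ω).prod

lemma edgeProd_append (X : Sym2 V → Ω → ℝ) (L L' : List (Sym2 V)) (ω : Ω) :
    edgeProd X (L ++ L') ω = edgeProd X L ω * edgeProd X L' ω := by
  simp [edgeProd]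

variable [MeasurableSpace Ω]

/-- Independent centred random variables with values in `[-1, 1]` and variance at most `δ`, indexed
by the unordered pairs of elements of `V`. -/
structure IsCentredFamily (P : Measure Ω) (δ : ℝ) (X : Sym2 V → Ω → ℝ) : Prop where
  indep : iIndepFun X P
  aemeasurable : ∀ e, AEMeasurable (X e) P
  abs_le_one : ∀ e, ∀ᵐ ω ∂P, |X e ω| ≤ 1
  mean : ∀ e, ∫ ω, X e ω ∂P = 0
  var : ∀ e, ∫ ω, X e ω ^ 2 ∂P ≤ δ

namespace IsCentredFamily

variable {P : Measure Ω} {δ : ℝ} {X : Sym2 V → Ω → ℝ}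

lemma aemeasurable_edgeProd (hX : IsCentredFamily P δ X) (L : List (Sym2 V)) :
    AEMeasurable (edgeProd X L) P := by
  induction L with
  | nil => exact aemeasurable_const (b := (1 : ℝ))
  | cons e L ih => exact (hX.aemeasurable e).mul ih

lemma ae_abs_edgeProd_le (hX : IsCentredFamily P δ X) (L : List (Sym2 V)) :
    ∀ᵐ ω ∂P, |edgeProd X L ω| ≤ 1 := by
  induction L with
  | nil => simp [edgeProd]
  | cons e L ih =>
    filter_upwards [hX.abs_le_one e, ih] with ω h1 h2
    have : edgeProd X (e :: L) ω = X e ω * edgeProd X L ω := rfl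
    rw [this, abs_mul]
    exact mul_le_one₀ h1 (abs_nonneg _) h2

lemma integrable_edgeProd [IsFiniteMeasure P] (hX : IsCentredFamily P δ X) (L : List (Sym2 V)) :
    Integrable (edgeProd X L) P :=
  Integrable.of_bound (hX.aemeasurable_edgeProd L).aestronglyMeasurable 1 (hX.ae_abs_edgeProd_le L)

lemma abs_integral_pow_le [IsProbabilityMeasure P] (hX : IsCentredFamily P δ X) (e : Sym2 V)
    {c : ℕ} (hc : 2 ≤ c) : |∫ ω, X e ω ^ c ∂P| ≤ δ := by
  have hint : Integrable (fun ω => X e ω ^ 2) P :=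
    Integrable.of_bound ((hX.aemeasurable e).pow_const 2).aestronglyMeasurable 1 (by
      filter_upwards [hX.abs_le_one e] with ω h
      rw [Real.norm_eq_abs, abs_pow]
      exact pow_le_one₀ (abs_nonneg _) h)
  refine (abs_integral_le_integral_abs).trans (le_trans ?_ (hX.var e))
  refine integral_mono_of_nonneg (Eventually.of_forall fun ω => abs_nonneg _) hint ?_
  filter_upwards [hX.abs_le_one e] with ω h
  change |X e ω ^ c| ≤ X e ω ^ 2
  rw [abs_pow, ← sq_abs (X e ω)]
  exact pow_le_pow_of_le_one (abs_nonneg _) h hc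

variable [Fintype V] [DecidableEq V]

lemma integral_edgeProd (hX : IsCentredFamily P δ X) (L : List (Sym2 V)) :
    ∫ ω, edgeProd X L ω ∂P = ∏ e, ∫ ω, X e ω ^ L.count e ∂P := by
  rw [← hX.indep.integral_fun_prod_comp (f := fun e x => x ^ L.count e) hX.aemeasurable
    (fun e => (measurable_id.pow_const _).aestronglyMeasurable)]
  refine integral_congr_ae (Eventually.of_forall fun ω => ?_)
  simp only [edgeProd]
  rw [Finset.prod_list_map_count]
  refine Finset.prod_subset (Finset.subset_univ _) fun e _ he => ?_
  rw [List.mem_toFinset] at he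
  rw [List.count_eq_zero_of_not_mem he, pow_zero]

/-- An edge traversed once contributes a zero mean. Otherwise every edge occurs at least twice, so
there are d ≤ n/2 distinct ones and the expectation is at most δ^d = t⁻ᵈ (δt)^d. The parameter `t`
is left free to balance fresh edges against returns in the count of walks. -/
lemma abs_integral_edgeProd_le [IsProbabilityMeasure P] (hX : IsCentredFamily P δ X)
    (hδ : 0 ≤ δ) {t : ℝ} (ht : 0 < t) (ht1 : t ≤ 1) (L : List (Sym2 V)) {n : ℕ}
    (hL : L.length = n) :
    |∫ ω, edgeProd X L ω ∂P| ≤ t⁻¹ ^ (n / 2) * (δ * t) ^ L.toFinset.card := by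
  have hR : 0 ≤ t⁻¹ ^ (n / 2) * (δ * t) ^ L.toFinset.card := by positivity
  rw [hX.integral_edgeProd L]
  by_cases h1 : ∃ e, L.count e = 1
  · obtain ⟨e, he⟩ := h1
    rw [Finset.prod_eq_zero (Finset.mem_univ e) (by rw [he]; simpa using hX.mean e)]
    simpa using hR
  push Not at h1
  have h2 : ∀ e ∈ L.toFinset, 2 ≤ L.count e := by
    intro e he
    have := h1 e
    have h3 : 0 < L.count e := List.count_pos_iff.2 (List.mem_toFinset.1 he)
    omega
  have h3 : L.toFinset.card ≤ n / 2 := by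
    have := Finset.sum_le_sum h2
    rw [List.sum_toFinset_count_eq_length, Finset.sum_const, smul_eq_mul, hL] at this
    omega
  rw [Finset.abs_prod]
  calc ∏ e, |∫ ω, X e ω ^ L.count e ∂P| = ∏ e ∈ L.toFinset, |∫ ω, X e ω ^ L.count e ∂P| := by
        symm
        refine Finset.prod_subset (Finset.subset_univ _) fun e _ he => ?_
        rw [List.mem_toFinset] at he
        rw [List.count_eq_zero_of_not_mem he]
        simp
    _ ≤ ∏ e ∈ L.toFinset, δ :=
        Finset.prod_le_prod (fun _ _ => abs_nonneg _) fun e he => hX.abs_integral_pow_le e (h2 e he)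
    _ = t⁻¹ ^ L.toFinset.card * (δ * t) ^ L.toFinset.card := by
        rw [Finset.prod_const, ← mul_pow]
        congr 1
        field_simp
    _ ≤ _ := by
        gcongr
        exact (one_le_inv₀ ht).2 ht1

-- Without a common edge the two products are independent. With one, both terms are bounded
-- separately: the concatenated list has length 2n, and δt ≤ 1 lets the separate edge counts be
-- replaced by that of the union.
open Classical in
lemma abs_covariance_edgeProd_le [IsProbabilityMeasure P] (hX : IsCentredFamily P δ X)
    (hδ : 0 ≤ δ) {t : ℝ} (ht : 0 < t) (ht1 : t ≤ 1) (hq : δ * t ≤ 1) (L L' : List (Sym2 V)) {n : ℕ}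
    (hL : L.length = n) (hL' : L'.length = n) :
    |∫ ω, edgeProd X L ω * edgeProd X L' ω ∂P -
        (∫ ω, edgeProd X L ω ∂P) * ∫ ω, edgeProd X L' ω ∂P| ≤
      if ∃ e ∈ L, e ∈ L' then 2 * t⁻¹ ^ n * (δ * t) ^ (L.toFinset ∪ L'.toFinset).card else 0 := by
  simp_rw [← edgeProd_append]
  split_ifs with h
  · have h1 := hX.abs_integral_edgeProd_le hδ ht ht1 (L ++ L') (n := n + n) (by simp [hL, hL'])
    have h2 := hX.abs_integral_edgeProd_le hδ ht ht1 L hL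
    have h3 := hX.abs_integral_edgeProd_le hδ ht ht1 L' hL'
    rw [List.toFinset_append, show (n + n) / 2 = n by omega] at h1
    have h4 : |(∫ ω, edgeProd X L ω ∂P) * ∫ ω, edgeProd X L' ω ∂P| ≤
        t⁻¹ ^ n * (δ * t) ^ (L.toFinset ∪ L'.toFinset).card := by
      rw [abs_mul]
      have hq0 : 0 ≤ δ * t := by positivity
      calc _ ≤ (t⁻¹ ^ (n / 2) * (δ * t) ^ L.toFinset.card) *
            (t⁻¹ ^ (n / 2) * (δ * t) ^ L'.toFinset.card) := by gcongr
        _ = t⁻¹ ^ (n / 2 + n / 2) * (δ * t) ^ (L.toFinset.card + L'.toFinset.card) := by ring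
        _ ≤ _ := by
          refine mul_le_mul (pow_le_pow_right₀ ((one_le_inv₀ ht).2 ht1) (by omega))
            (pow_le_pow_of_le_one hq0 hq (Finset.card_union_le _ _)) (by positivity) (by positivity)
    calc _ ≤ _ := abs_sub _ _
      _ ≤ _ := add_le_add h1 h4
      _ = _ := by ring
  · push Not at h
    rw [hX.integral_edgeProd, hX.integral_edgeProd, hX.integral_edgeProd, ← Finset.prod_mul_distrib,
      sub_eq_zero.2, abs_zero]
    refine Finset.prod_congr rfl fun e _ => ?_
    rw [List.count_append]
    by_cases he : e ∈ L
    · rw [List.count_eq_zero_of_not_mem (h e he)]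
      simp
    · rw [List.count_eq_zero_of_not_mem he]
      simp

end IsCentredFamily

variable [Fintype V] [DecidableEq V]

-- Expanding the matrix product produces all walks from `a`. The default in `getLastD` says that the
-- walk of length zero ends where it starts.
omit [MeasurableSpace Ω] in
lemma symMatrix_pow_mulVec (X : Sym2 V → Ω → ℝ) (ω : Ω) (v : V → ℝ) (n : ℕ) (a : V) :
    (symMatrix X ω ^ n).mulVec v a = ∑ w : Fin n → V,
      edgeProd X (walkEdges a (List.ofFn w)) ω * v ((List.ofFn w).getLastD a) := by
  induction n generalizing a with
  | zero => simp [edgeProd]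
  | succ n ih =>
    rw [pow_succ', ← Matrix.mulVec_mulVec, sum_fin_succ_fun, Matrix.mulVec, dotProduct]
    refine Finset.sum_congr rfl fun b _ => ?_
    rw [ih, Finset.mul_sum]
    refine Finset.sum_congr rfl fun w _ => ?_
    simp only [List.ofFn_succ, Fin.cons_zero, Fin.cons_succ, walkEdges_cons, edgeProd, List.map_cons,
      List.prod_cons, symMatrix_apply, mul_assoc, List.getLastD_cons]

omit [MeasurableSpace Ω] in
lemma dotProduct_symMatrix_pow_mulVec (X : Sym2 V → Ω → ℝ) (ω : Ω) (u v : V → ℝ) (n : ℕ) :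
    u ⬝ᵥ (symMatrix X ω ^ n).mulVec v = ∑ p : V × (Fin n → V),
      (u p.1 * v ((List.ofFn p.2).getLastD p.1)) *
        edgeProd X (walkEdges p.1 (List.ofFn p.2)) ω := by
  simp_rw [dotProduct, symMatrix_pow_mulVec, Finset.mul_sum, Fintype.sum_prod_type]
  refine Finset.sum_congr rfl fun b _ => Finset.sum_congr rfl fun w _ => ?_
  ring

omit [MeasurableSpace Ω] in
lemma sum_walk_univ_le {q : ℝ} (hq : 0 ≤ q) (n : ℕ) :
    ∑ p : V × (Fin n → V), q ^ (walkEdges p.1 (List.ofFn p.2)).toFinset.card ≤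
      Fintype.card V * (Fintype.card V * q + (n + 1)) ^ n := by
  rw [Fintype.sum_prod_type]
  calc _ ≤ ∑ a : V, (Fintype.card V * q + (n + 1)) ^ n := by
        refine Finset.sum_le_sum fun a _ => ?_
        have := sum_walk_le (D := n + 1) hq n ∅ {a} (by simp) a (by simp) (by simp [add_comm])
        simpa using this
    _ = _ := by simp

namespace IsCentredFamily

variable {P : Measure Ω} {δ : ℝ} {X : Sym2 V → Ω → ℝ} [IsProbabilityMeasure P]

lemma integrable_dotProduct_pow (hX : IsCentredFamily P δ X) (u v : V → ℝ) (n : ℕ) :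
    Integrable (fun ω => u ⬝ᵥ (symMatrix X ω ^ n).mulVec v) P := by
  simp_rw [dotProduct_symMatrix_pow_mulVec]
  exact integrable_finsetSum _ fun p _ => (hX.integrable_edgeProd _).const_mul _

/-- The expectation of a quadratic form of a power is governed by walks in which every edge is
traversed at least twice. -/
lemma abs_integral_dotProduct_pow_le (hX : IsCentredFamily P δ X) (hδ : 0 ≤ δ) {t : ℝ}
    (ht : 0 < t) (ht1 : t ≤ 1) {u v : V → ℝ} {α β : ℝ} (hu : ∀ a, |u a| ≤ α) (hv : ∀ a, |v a| ≤ β)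
    (hα : 0 ≤ α) (hβ : 0 ≤ β) (n : ℕ) :
    |∫ ω, u ⬝ᵥ (symMatrix X ω ^ n).mulVec v ∂P| ≤
      α * β * (t⁻¹ ^ (n / 2) *
        (Fintype.card V * (Fintype.card V * (δ * t) + (n + 1)) ^ n)) := by
  simp_rw [dotProduct_symMatrix_pow_mulVec]
  rw [integral_finsetSum _ fun p _ => (hX.integrable_edgeProd _).const_mul _]
  simp_rw [integral_const_mul]
  refine (Finset.abs_sum_le_sum_abs _ _).trans ?_
  calc _ ≤ ∑ p : V × (Fin n → V), α * β * (t⁻¹ ^ (n / 2) *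
          (δ * t) ^ (walkEdges p.1 (List.ofFn p.2)).toFinset.card) := by
        refine Finset.sum_le_sum fun p _ => ?_
        rw [abs_mul, abs_mul]
        gcongr
        · exact hu _
        · exact hv _
        · exact hX.abs_integral_edgeProd_le hδ ht ht1 _ (by simp)
    _ ≤ _ := by
        rw [← Finset.mul_sum, ← Finset.mul_sum]
        gcongr
        exact sum_walk_univ_le (by positivity) n

/-- The variance of a quadratic form of a power is governed by pairs of walks with a common edge. -/
lemma variance_dotProduct_pow_le (hX : IsCentredFamily P δ X) (hδ : 0 ≤ δ) {t : ℝ}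
    (ht : 0 < t) (ht1 : t ≤ 1) (hq : δ * t ≤ 1) {u v : V → ℝ} {α β : ℝ} (hu : ∀ a, |u a| ≤ α)
    (hv : ∀ a, |v a| ≤ β) (hα : 0 ≤ α) (hβ : 0 ≤ β) (n : ℕ) :
    ∫ ω, (u ⬝ᵥ (symMatrix X ω ^ n).mulVec v -
        ∫ ω', u ⬝ᵥ (symMatrix X ω' ^ n).mulVec v ∂P) ^ 2 ∂P ≤
      (α * β) ^ 2 * (2 * t⁻¹ ^ n * ((n + 1) * (n + 1) *
        (Fintype.card V * (δ * t) + (2 * n + 1)) ^ n *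
        (Fintype.card V * (Fintype.card V * (δ * t) + (n + 1)) ^ n))) := by
  classical
  set q := δ * t with hqdef
  have hq0 : 0 ≤ q := by positivity
  set L : V × (Fin n → V) → List (Sym2 V) := fun p => walkEdges p.1 (List.ofFn p.2) with hL
  set c : V × (Fin n → V) → ℝ := fun p => u p.1 * v ((List.ofFn p.2).getLastD p.1) with hc
  have hcb : ∀ p, |c p| ≤ α * β := fun p => by
    rw [hc, abs_mul]
    exact mul_le_mul (hu _) (hv _) (abs_nonneg _) hα
  have hlen : ∀ p, (L p).length = n := fun p => by simp [hL]
  have hY : ∀ ω, u ⬝ᵥ (symMatrix X ω ^ n).mulVec v = ∑ p, c p * edgeProd X (L p) ω :=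
    fun ω => dotProduct_symMatrix_pow_mulVec X ω u v n
  have hint := fun p => (hX.integrable_edgeProd (L p))
  have hint2 : ∀ p p', Integrable (fun ω => edgeProd X (L p) ω * edgeProd X (L p') ω) P := by
    intro p p'
    simp_rw [← edgeProd_append]
    exact hX.integrable_edgeProd _
  have hm : ∫ ω, ∑ p, c p * edgeProd X (L p) ω ∂P = ∑ p, c p * ∫ ω, edgeProd X (L p) ω ∂P := by
    rw [integral_finsetSum _ fun p _ => (hint p).const_mul _]
    simp_rw [integral_const_mul]
  simp_rw [hY]
  rw [hm]
  have hexp : ∀ ω, (∑ p, c p * edgeProd X (L p) ω - ∑ p, c p * ∫ ω, edgeProd X (L p) ω ∂P) ^ 2 =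
      ∑ p, ∑ p', c p * c p' * ((edgeProd X (L p) ω - ∫ ω, edgeProd X (L p) ω ∂P) *
        (edgeProd X (L p') ω - ∫ ω, edgeProd X (L p') ω ∂P)) := by
    intro ω
    rw [← Finset.sum_sub_distrib, sq, Finset.sum_mul_sum]
    refine Finset.sum_congr rfl fun p _ => Finset.sum_congr rfl fun p' _ => ?_
    ring
  have hcov : ∀ p p', Integrable (fun ω => (edgeProd X (L p) ω - ∫ ω, edgeProd X (L p) ω ∂P) *
        (edgeProd X (L p') ω - ∫ ω, edgeProd X (L p') ω ∂P)) P ∧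
      ∫ ω, (edgeProd X (L p) ω - ∫ ω, edgeProd X (L p) ω ∂P) *
        (edgeProd X (L p') ω - ∫ ω, edgeProd X (L p') ω ∂P) ∂P =
      ∫ ω, edgeProd X (L p) ω * edgeProd X (L p') ω ∂P -
        (∫ ω, edgeProd X (L p) ω ∂P) * ∫ ω, edgeProd X (L p') ω ∂P := by
    intro p p'
    set x := ∫ ω, edgeProd X (L p) ω ∂P with hx
    set y := ∫ ω, edgeProd X (L p') ω ∂P with hy
    have h0 : (fun ω => (edgeProd X (L p) ω - x) * (edgeProd X (L p') ω - y)) =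
        fun ω => edgeProd X (L p) ω * edgeProd X (L p') ω - y * edgeProd X (L p) ω -
          (x * edgeProd X (L p') ω - x * y) := by
      ext ω
      ring
    have i1 := (hint2 p p').sub ((hint p).const_mul y)
    have i2 := ((hint p').const_mul x).sub (integrable_const (μ := P) (x * y))
    refine ⟨by rw [h0]; exact i1.sub i2, ?_⟩
    have e0 : ∫ ω, (edgeProd X (L p) ω * edgeProd X (L p') ω - y * edgeProd X (L p) ω -
        (x * edgeProd X (L p') ω - x * y)) ∂P = _ := integral_sub i1 i2
    have e1 : ∫ ω, (edgeProd X (L p) ω * edgeProd X (L p') ω - y * edgeProd X (L p) ω) ∂P = _ :=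
      integral_sub (hint2 p p') ((hint p).const_mul y)
    have e2 : ∫ ω, (x * edgeProd X (L p') ω - x * y) ∂P = _ :=
      integral_sub ((hint p').const_mul x) (integrable_const (μ := P) (x * y))
    rw [integral_const_mul, ← hx] at e1
    rw [integral_const_mul, integral_const, ← hy, probReal_univ, one_smul] at e2
    rw [h0, e0]
    rw [e1, e2]
    ring
  simp_rw [hexp]
  rw [integral_finsetSum _ fun p _ => integrable_finsetSum _ fun p' _ =>
    ((hcov p p').1.const_mul _)]
  -- A common edge has an endpoint on both walks, so the condition is relaxed to a common vertex,
  -- which is what `sum_walk_meet_le` counts.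
  have h1 : ∀ p, ∫ ω, ∑ p', c p * c p' * ((edgeProd X (L p) ω - ∫ ω, edgeProd X (L p) ω ∂P) *
        (edgeProd X (L p') ω - ∫ ω, edgeProd X (L p') ω ∂P)) ∂P ≤
      ∑ p', (α * β) ^ 2 * (2 * t⁻¹ ^ n * if ∃ x ∈ p'.1 :: List.ofFn p'.2,
        x ∈ (p.1 :: List.ofFn p.2).toFinset then
          q ^ ((L p).toFinset ∪ (L p').toFinset).card else 0) := by
    intro p
    rw [integral_finsetSum _ fun p' _ => ((hcov p p').1.const_mul _)]
    refine Finset.sum_le_sum fun p' _ => ?_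
    rw [integral_const_mul, (hcov p p').2]
    refine (le_abs_self _).trans ?_
    rw [abs_mul, abs_mul, sq (α * β)]
    have h2 := hX.abs_covariance_edgeProd_le hδ ht ht1 hq (L p) (L p') (hlen p) (hlen p')
    have hαβ : 0 ≤ α * β := by positivity
    refine mul_le_mul (mul_le_mul (hcb p) (hcb p') (abs_nonneg _) hαβ) (h2.trans ?_) (abs_nonneg _)
      (by positivity)
    split_ifs with h3 h4 h4
    · exact le_rfl
    · exfalso
      obtain ⟨e, he, he'⟩ := h3
      obtain ⟨x, hx⟩ : ∃ x, x ∈ e := ⟨_, e.out_fst_mem⟩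
      exact h4 ⟨x, mem_of_mem_walkEdges he' hx,
        List.mem_toFinset.2 (mem_of_mem_walkEdges he hx)⟩
    · positivity
    · simp
  refine (Finset.sum_le_sum fun p _ => h1 p).trans ?_
  simp_rw [← Finset.mul_sum]
  have h2 : ∀ p, ∑ p' : V × (Fin n → V), (if ∃ x ∈ p'.1 :: List.ofFn p'.2,
        x ∈ (p.1 :: List.ofFn p.2).toFinset then
          q ^ ((L p).toFinset ∪ (L p').toFinset).card else 0) ≤
      q ^ (L p).toFinset.card * ((n + 1) * (n + 1) * (Fintype.card V * q + (2 * n + 1)) ^ n) := by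
    intro p
    have hcard : ((p.1 :: List.ofFn p.2).toFinset.card : ℝ) ≤ n + 1 := by
      have := List.toFinset_card_le (p.1 :: List.ofFn p.2)
      rw [List.length_cons, List.length_ofFn] at this
      exact_mod_cast this
    -- The first walk has at most n + 1 vertices and the second makes n more steps, whence 2n + 1.
    have h3 := sum_walk_meet_le (D := 2 * n + 1) hq0 n (L p).toFinset
      (p.1 :: List.ofFn p.2).toFinset (by
        intro e he x hx
        rw [List.mem_toFinset] at he ⊢
        exact mem_of_mem_walkEdges he hx) (by linarith)
    rw [Fintype.sum_prod_type]
    refine h3.trans ?_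
    gcongr
  calc _ ≤ (α * β) ^ 2 * (2 * t⁻¹ ^ n * ∑ p : V × (Fin n → V), q ^ (L p).toFinset.card *
        ((n + 1) * (n + 1) * (Fintype.card V * q + (2 * n + 1)) ^ n)) := by
        gcongr with p _
        exact h2 p
    _ = (α * β) ^ 2 * (2 * t⁻¹ ^ n * (((n + 1) * (n + 1) *
        (Fintype.card V * q + (2 * n + 1)) ^ n) *
        ∑ p : V × (Fin n → V), q ^ (L p).toFinset.card)) := by
        rw [← Finset.sum_mul, mul_comm (∑ p, _)]
    _ ≤ _ := by
        gcongr
        exact sum_walk_univ_le hq0 n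

/-- The expected trace of an even power. -/
lemma integral_trace_pow_le (hX : IsCentredFamily P δ X) (hδ : 0 ≤ δ) {t : ℝ}
    (ht : 0 < t) (ht1 : t ≤ 1) (n : ℕ) :
    Integrable (fun ω => (symMatrix X ω ^ n).trace) P ∧
    ∫ ω, (symMatrix X ω ^ n).trace ∂P ≤ t⁻¹ ^ (n / 2) *
        (Fintype.card V * (Fintype.card V * (δ * t) + (n + 1)) ^ n) := by
  have h0 : ∀ ω, (symMatrix X ω ^ n).trace = ∑ p : V × (Fin n → V),
      (if (List.ofFn p.2).getLastD p.1 = p.1 then 1 else 0) *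
        edgeProd X (walkEdges p.1 (List.ofFn p.2)) ω := by
    intro ω
    rw [Matrix.trace, Fintype.sum_prod_type]
    refine Finset.sum_congr rfl fun a _ => ?_
    -- A standard basis vector selects the closed walks. The bound below ignores the restriction and
    -- counts all walks.
    have := symMatrix_pow_mulVec X ω (Pi.single a 1) n a
    rw [Matrix.mulVec_single_one, Matrix.col_apply] at this
    rw [Matrix.diag_apply, this]
    refine Finset.sum_congr rfl fun w _ => ?_
    rw [mul_comm, Pi.single_apply]
  simp_rw [h0]
  refine ⟨integrable_finsetSum _ fun p _ => (hX.integrable_edgeProd _).const_mul _, ?_⟩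
  rw [integral_finsetSum _ fun p _ => (hX.integrable_edgeProd _).const_mul _]
  simp_rw [integral_const_mul]
  calc _ ≤ ∑ p : V × (Fin n → V), (t⁻¹ ^ (n / 2) *
          (δ * t) ^ (walkEdges p.1 (List.ofFn p.2)).toFinset.card) := by
        refine Finset.sum_le_sum fun p _ => ?_
        have := hX.abs_integral_edgeProd_le hδ ht ht1 (walkEdges p.1 (List.ofFn p.2)) (n := n)
          (by simp)
        split_ifs
        · rw [one_mul]
          exact (le_abs_self _).trans this
        · rw [zero_mul]
          exact (abs_nonneg _).trans this
    _ ≤ _ := by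
        rw [← Finset.mul_sum]
        gcongr
        exact sum_walk_univ_le (by positivity) n

end IsCentredFamily

end Moments

/-! ### Variational bounds for ordered eigenvalues -/

section Eig

open Matrix

variable {n : ℕ} {M M' : Matrix (Fin n) (Fin n) ℝ}

lemma isHermitian_of_isSymm (hM : M.IsSymm) : M.IsHermitian := by
  rw [Matrix.IsHermitian, Matrix.conjTranspose_eq_transpose_of_trivial]
  exact hM

lemma eig_antitone (hM : M.IsSymm) {i j : ℕ} (hij : i ≤ j) (hj : j < n) : eig M j ≤ eig M i := by
  have h := isHermitian_of_isSymm hM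
  rw [eig, eig, dif_pos ⟨h, hj⟩, dif_pos ⟨h, hij.trans_lt hj⟩]
  exact h.eigenvalues₀_antitone hij

lemma dotProduct_mulVec_comm_of_isSymm {m : Type*} [Fintype m] {Q : Matrix m m ℝ} (hQ : Q.IsSymm)
    (x y : m → ℝ) : x ⬝ᵥ Q *ᵥ y = (Q *ᵥ x) ⬝ᵥ y := by
  rw [Matrix.dotProduct_mulVec, ← Matrix.mulVec_transpose, hQ.eq]

/-- An orthonormal basis of eigenvectors, listed along the ordered eigenvalues. -/
lemma exists_eigenbasis (hM : M.IsSymm) : ∃ b : Fin n → Fin n → ℝ,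
    (∀ j, M *ᵥ b j = eig M j • b j) ∧ (∀ x y : Fin n → ℝ, x ⬝ᵥ y = ∑ j, (b j ⬝ᵥ x) * (b j ⬝ᵥ y)) ∧
    (∀ x : Fin n → ℝ, x = ∑ j, (b j ⬝ᵥ x) • b j) ∧ ∀ j, b j ⬝ᵥ b j = 1 := by
  have h := isHermitian_of_isSymm hM
  -- This undoes the reindexing inside `eigenvalues`, so that the j-th vector belongs to the j-th
  -- largest eigenvalue.
  set σ : Fin n ≃ Fin n := (finCongr (Fintype.card_fin n)).symm.trans
    (Fintype.equivOfCardEq (Fintype.card_fin _)) with hσ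
  have hin : ∀ (x y : EuclideanSpace ℝ (Fin n)), inner ℝ x y = x.ofLp ⬝ᵥ y.ofLp := fun x y => by
    rw [EuclideanSpace.inner_eq_star_dotProduct, dotProduct_comm]
    rfl
  refine ⟨fun j => (h.eigenvectorBasis (σ j)).ofLp, fun j => ?_, fun x y => ?_, fun x => ?_, fun j => ?_⟩
  · have h1 := h.mulVec_eigenvectorBasis (σ j)
    have h2 : h.eigenvalues (σ j) = eig M j := by
      rw [eig, dif_pos ⟨h, j.2⟩, Matrix.IsHermitian.eigenvalues]
      congr 1
      simp [hσ]
      rfl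
    rw [h2] at h1
    exact h1
  · have h1 := (h.eigenvectorBasis.sum_inner_mul_inner (WithLp.toLp 2 x) (WithLp.toLp 2 y)).symm
    simp only [hin] at h1
    rw [h1, ← σ.sum_comp]
    refine Finset.sum_congr rfl fun j _ => ?_
    rw [dotProduct_comm]
  · have h1 := congrArg WithLp.ofLp (h.eigenvectorBasis.sum_repr' (WithLp.toLp 2 x)).symm
    simp only [hin] at h1
    rw [WithLp.ofLp_sum, ← σ.sum_comp] at h1
    exact h1
  · rw [← hin, real_inner_self_eq_norm_sq, h.eigenvectorBasis.norm_eq_one, one_pow]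

lemma dotProduct_self_pos {m : Type*} [Fintype m] {x : m → ℝ} (hx : x ≠ 0) : 0 < x ⬝ᵥ x := by
  have h : 0 ≤ x ⬝ᵥ x := Finset.sum_nonneg fun _ _ => mul_self_nonneg _
  exact lt_of_le_of_ne h fun h0 => hx (dotProduct_self_eq_zero.1 h0.symm)

lemma quadForm_eq_sum {b : Fin n → Fin n → ℝ} (hM : M.IsSymm)
    (hb : ∀ j, M *ᵥ b j = eig M j • b j)
    (hp : ∀ x y : Fin n → ℝ, x ⬝ᵥ y = ∑ j, (b j ⬝ᵥ x) * (b j ⬝ᵥ y)) (x : Fin n → ℝ) :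
    x ⬝ᵥ M *ᵥ x = ∑ j : Fin n, eig M j * (b j ⬝ᵥ x) ^ 2 := by
  rw [hp]
  refine Finset.sum_congr rfl fun j _ => ?_
  rw [dotProduct_mulVec_comm_of_isSymm hM, hb, smul_dotProduct, smul_eq_mul]
  ring

/-- Lower bound for an eigenvalue from a subspace of test vectors. -/
lemma le_eig (hM : M.IsSymm) {i : ℕ} (hi : i < n) {t : ℝ} (L : (Fin (i + 1) → ℝ) →ₗ[ℝ] (Fin n → ℝ))
    (hL : ∀ c, L c = 0 → c = 0) (h : ∀ c, t * (L c ⬝ᵥ L c) ≤ L c ⬝ᵥ M *ᵥ L c) : t ≤ eig M i := by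
  obtain ⟨b, hb, hp, -⟩ := exists_eigenbasis hM
  -- The i + 1 parameters exceed the i conditions of orthogonality to the leading eigenvectors, so a
  -- nonzero test vector satisfies them all.
  let φ : (Fin (i + 1) → ℝ) →ₗ[ℝ] (Fin i → ℝ) :=
    LinearMap.pi fun j => (dotProductBilin ℝ ℝ (b ⟨j, j.2.trans hi⟩)) ∘ₗ L
  have hker : LinearMap.ker φ ≠ ⊥ := LinearMap.ker_ne_bot_of_finrank_lt (by simp)
  obtain ⟨c, hc, hc0⟩ := Submodule.exists_mem_ne_zero_of_ne_bot hker
  have hz : ∀ j : Fin n, (j : ℕ) < i → b j ⬝ᵥ L c = 0 := fun j hj =>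
    congrFun (LinearMap.mem_ker.1 hc) ⟨j, hj⟩
  have hpos : 0 < L c ⬝ᵥ L c := dotProduct_self_pos fun h0 => hc0 (hL c h0)
  have h1 := h c
  rw [quadForm_eq_sum hM hb hp] at h1
  have h2 : ∑ j : Fin n, eig M j * (b j ⬝ᵥ L c) ^ 2 ≤ eig M i * (L c ⬝ᵥ L c) := by
    rw [hp (L c), Finset.mul_sum]
    refine Finset.sum_le_sum fun j _ => ?_
    rcases lt_or_ge (j : ℕ) i with hj | hj
    · simp [hz j hj]
    · rw [← sq]
      exact mul_le_mul_of_nonneg_right (eig_antitone hM hj j.2) (sq_nonneg _)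
  exact le_of_mul_le_mul_right (h1.trans h2) hpos

/-- Upper bound for an eigenvalue from a subspace of test vectors of small codimension. -/
lemma eig_le (hM : M.IsSymm) {i : ℕ} (hi : i < n) {t : ℝ} (ψ : (Fin n → ℝ) →ₗ[ℝ] (Fin i → ℝ))
    (h : ∀ x, ψ x = 0 → x ⬝ᵥ M *ᵥ x ≤ t * (x ⬝ᵥ x)) : eig M i ≤ t := by
  obtain ⟨b, hb, hp, -⟩ := exists_eigenbasis hM
  -- Together with the i conditions of `ψ`, orthogonality to the eigenvectors after the i-th imposes
  -- n - 1 conditions, which leaves a nonzero vector.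
  let φ : (Fin n → ℝ) →ₗ[ℝ] (Fin (n - (i + 1)) → ℝ) :=
    LinearMap.pi fun j => dotProductBilin ℝ ℝ (b ⟨j + (i + 1), by omega⟩)
  have hker : LinearMap.ker (ψ.prod φ) ≠ ⊥ := LinearMap.ker_ne_bot_of_finrank_lt (by
    simp
    omega)
  obtain ⟨x, hx, hx0⟩ := Submodule.exists_mem_ne_zero_of_ne_bot hker
  replace hx : ψ x = 0 ∧ φ x = 0 := Prod.mk_eq_zero.1 (LinearMap.mem_ker.1 hx)
  have hz : ∀ j : Fin n, i < (j : ℕ) → b j ⬝ᵥ x = 0 := fun j hj => by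
    have := congrFun hx.2 ⟨j - (i + 1), by omega⟩
    have h3 : (⟨(j : ℕ) - (i + 1) + (i + 1), by omega⟩ : Fin n) = j := Fin.ext (by simp; omega)
    change b _ ⬝ᵥ x = 0 at this
    rwa [h3] at this
  have hpos : 0 < x ⬝ᵥ x := dotProduct_self_pos hx0
  have h1 := h x hx.1
  rw [quadForm_eq_sum hM hb hp] at h1
  have h2 : eig M i * (x ⬝ᵥ x) ≤ ∑ j : Fin n, eig M j * (b j ⬝ᵥ x) ^ 2 := by
    rw [hp x, Finset.mul_sum]
    refine Finset.sum_le_sum fun j _ => ?_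
    rcases lt_or_ge i (j : ℕ) with hj | hj
    · simp [hz j hj]
    · rw [← sq]
      exact mul_le_mul_of_nonneg_right (eig_antitone hM hj hi) (sq_nonneg _)
  exact le_of_mul_le_mul_right (h2.trans h1) hpos

/-- The test space of `eig_le` is the orthogonal complement of the first i eigenvectors of `M'`, on
which the form of `M'` is at most its i-th eigenvalue. -/
lemma eig_le_eig_add (hM : M.IsSymm) (hM' : M'.IsSymm) {i : ℕ} (hi : i < n) {s : ℝ}
    (h : ∀ x, x ⬝ᵥ M *ᵥ x ≤ x ⬝ᵥ M' *ᵥ x + s * (x ⬝ᵥ x)) : eig M i ≤ eig M' i + s := by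
  obtain ⟨b, hb, hp, -⟩ := exists_eigenbasis hM'
  let φ : (Fin n → ℝ) →ₗ[ℝ] (Fin i → ℝ) :=
    LinearMap.pi fun j => dotProductBilin ℝ ℝ (b ⟨j, j.2.trans hi⟩)
  refine eig_le hM hi φ fun x hx => (h x).trans ?_
  have hz : ∀ j : Fin n, (j : ℕ) < i → b j ⬝ᵥ x = 0 := fun j hj => congrFun hx ⟨j, hj⟩
  rw [add_mul]
  gcongr
  rw [quadForm_eq_sum hM' hb hp, hp x, Finset.mul_sum]
  refine Finset.sum_le_sum fun j _ => ?_
  rcases lt_or_ge (j : ℕ) i with hj | hj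
  · simp [hz j hj]
  · rw [← sq]
    exact mul_le_mul_of_nonneg_right (eig_antitone hM' hj j.2) (sq_nonneg _)

/-- Each product |x_j x_l| is at most x ⬝ᵥ x. The crude entrywise norm is affordable where the
dimension k is fixed. -/
lemma abs_quadForm_le (Q : Matrix (Fin n) (Fin n) ℝ) (x : Fin n → ℝ) :
    |x ⬝ᵥ Q *ᵥ x| ≤ (∑ j, ∑ l, |Q j l|) * (x ⬝ᵥ x) := by
  have hsq : ∀ j, x j ^ 2 ≤ x ⬝ᵥ x := fun j => by
    rw [sq]
    exact Finset.single_le_sum (f := fun j => x j * x j) (fun _ _ => mul_self_nonneg _)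
      (Finset.mem_univ j)
  generalize x ⬝ᵥ x = s at hsq
  simp_rw [dotProduct, mulVec, dotProduct, Finset.mul_sum, Finset.sum_mul]
  refine (Finset.abs_sum_le_sum_abs _ _).trans (Finset.sum_le_sum fun j _ => ?_)
  refine (Finset.abs_sum_le_sum_abs _ _).trans (Finset.sum_le_sum fun l _ => ?_)
  have h1 : |x j * (Q j l * x l)| = |Q j l| * (|x j| * |x l|) := by
    rw [abs_mul, abs_mul]
    ring
  rw [h1]
  gcongr
  have h2 := hsq j
  have h3 := hsq l
  nlinarith [sq_nonneg (|x j| - |x l|), sq_abs (x j), sq_abs (x l)]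

/-- Weyl's inequality, with the entrywise `ℓ¹` norm. -/
lemma abs_eig_sub_eig_le (hM : M.IsSymm) (hM' : M'.IsSymm) {i : ℕ} (hi : i < n) :
    |eig M i - eig M' i| ≤ ∑ j, ∑ l, |M j l - M' j l| := by
  have h : ∀ x, |x ⬝ᵥ M *ᵥ x - x ⬝ᵥ M' *ᵥ x| ≤ (∑ j, ∑ l, |M j l - M' j l|) * (x ⬝ᵥ x) := by
    intro x
    rw [← dotProduct_sub, ← sub_mulVec]
    exact abs_quadForm_le (M - M') x
  rw [abs_sub_le_iff]
  constructor
  · linarith [eig_le_eig_add hM hM' hi fun x => by linarith [(abs_le.1 (h x)).2]]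
  · linarith [eig_le_eig_add hM' hM hi fun x => by linarith [(abs_le.1 (h x)).1]]

lemma exists_eigenvector (hM : M.IsSymm) {i : ℕ} (hi : i < n) :
    ∃ x : Fin n → ℝ, x ≠ 0 ∧ M *ᵥ x = eig M i • x := by
  obtain ⟨b, hb, -, -, hn⟩ := exists_eigenbasis hM
  refine ⟨b ⟨i, hi⟩, fun h0 => ?_, hb ⟨i, hi⟩⟩
  simpa [h0] using hn ⟨i, hi⟩

/-- Were μ different from every eigenvalue in the list, `y` would be orthogonal to the whole
eigenbasis. -/
lemma exists_eq_eig_of_eigenvector (hM : M.IsSymm) {μ : ℝ} {y : Fin n → ℝ} (hy : y ≠ 0)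
    (h : M *ᵥ y = μ • y) : ∃ j : Fin n, μ = eig M j := by
  obtain ⟨b, hb, -, hs, -⟩ := exists_eigenbasis hM
  by_contra! hne
  apply hy
  rw [hs y]
  refine Finset.sum_eq_zero fun j _ => ?_
  have h1 : b j ⬝ᵥ M *ᵥ y = μ * (b j ⬝ᵥ y) := by rw [h, dotProduct_smul, smul_eq_mul]
  rw [dotProduct_mulVec_comm_of_isSymm hM, hb, smul_dotProduct, smul_eq_mul] at h1
  have h2 : (μ - eig M j) * (b j ⬝ᵥ y) = 0 := by linarith
  rcases mul_eq_zero.1 h2 with h3 | h3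
  · exact absurd (by linarith) (hne j)
  · rw [h3, zero_smul]

end Eig

/-! ### Deterministic perturbation of an isolated eigenvalue -/

section Perturbation

open Matrix

lemma dotProduct_sq_le {m : Type*} [Fintype m] (x y : m → ℝ) :
    (x ⬝ᵥ y) ^ 2 ≤ (x ⬝ᵥ x) * (y ⬝ᵥ y) := by
  have := Finset.sum_mul_sq_le_sq_mul_sq Finset.univ x y
  simpa [dotProduct, sq] using this

lemma dotProduct_self_nonneg' {m : Type*} [Fintype m] (x : m → ℝ) : 0 ≤ x ⬝ᵥ x :=
  Finset.sum_nonneg fun _ _ => mul_self_nonneg _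

lemma abs_dotProduct_le {m : Type*} [Fintype m] (x y : m → ℝ) {t : ℝ} (ht : 0 < t) :
    |x ⬝ᵥ y| ≤ (t * (x ⬝ᵥ x) + t⁻¹ * (y ⬝ᵥ y)) / 2 := by
  have hx := dotProduct_self_nonneg' x
  have hy := dotProduct_self_nonneg' y
  refine abs_le_of_sq_le_sq ?_ (by positivity)
  refine (dotProduct_sq_le x y).trans ?_
  have h1 : (x ⬝ᵥ x) * (y ⬝ᵥ y) = (t * (x ⬝ᵥ x)) * (t⁻¹ * (y ⬝ᵥ y)) := by field_simp
  rw [h1]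
  nlinarith [sq_nonneg (t * (x ⬝ᵥ x) - t⁻¹ * (y ⬝ᵥ y))]

variable {N k : ℕ}

/-- Almost orthonormal vectors. -/
def IsAlmostOrthonormal {ι : Type*} [DecidableEq ι] (η : ℝ) (e : ι → Fin N → ℝ) : Prop :=
  ∀ j l, |e j ⬝ᵥ e l - if j = l then 1 else 0| ≤ η

/-- The Gram matrix minus the identity has m² entries, each at most η in absolute value. -/
lemma IsAlmostOrthonormal.abs_sum_sub_le {η : ℝ} {m : ℕ} {e : Fin m → Fin N → ℝ}
    (he : IsAlmostOrthonormal η e) (c : Fin m → ℝ) :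
    |(∑ j, c j • e j) ⬝ᵥ (∑ j, c j • e j) - c ⬝ᵥ c| ≤ m ^ 2 * η * (c ⬝ᵥ c) := by
  have h := abs_quadForm_le (Matrix.of fun j l => e j ⬝ᵥ e l - if j = l then 1 else 0) c
  have h1 : c ⬝ᵥ (Matrix.of fun j l => e j ⬝ᵥ e l - if j = l then (1 : ℝ) else 0) *ᵥ c =
      (∑ j, c j • e j) ⬝ᵥ (∑ j, c j • e j) - c ⬝ᵥ c := by
    simp only [sum_dotProduct, dotProduct_sum, smul_dotProduct, dotProduct_smul, smul_eq_mul]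
    simp only [dotProduct, mulVec, Matrix.of_apply, sub_mul, Finset.mul_sum,
      Finset.sum_sub_distrib, mul_sub, ite_mul, one_mul, zero_mul, Finset.sum_ite_eq,
      Finset.mem_univ, if_true, Finset.sum_mul]
    congr 1
    refine Finset.sum_congr rfl fun j _ => Finset.sum_congr rfl fun l _ =>
      Finset.sum_congr rfl fun a _ => ?_
    ring
  rw [h1] at h
  refine h.trans ?_
  gcongr
  · exact dotProduct_self_nonneg' c
  · calc _ ≤ ∑ j : Fin m, ∑ l : Fin m, η :=
          Finset.sum_le_sum fun j _ => Finset.sum_le_sum fun l _ => he j l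
      _ = _ := by simp; ring

/-- Crude localisation of the eigenvalues of a perturbed spectral sum. -/
lemma abs_eig_sub_mul_le {e : Fin k → Fin N → ℝ} {θ : Fin k → ℝ} {s η b : ℝ} (hθ : Antitone θ)
    (hθ0 : ∀ j, 0 ≤ θ j) (hs : 0 ≤ s) (he : IsAlmostOrthonormal η e) (hη : k ^ 2 * η < 1)
    {A : Matrix (Fin N) (Fin N) ℝ} (hA : A.IsSymm)
    (hAb : ∀ x, |x ⬝ᵥ A *ᵥ x - s * ∑ j, θ j * (e j ⬝ᵥ x) ^ 2| ≤ b * (x ⬝ᵥ x))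
    (i : Fin k) (hi : (i : ℕ) < N) :
    |eig A i - s * θ i| ≤ b + s * θ i * (k ^ 2 * η) := by
  have hη0 : 0 ≤ η := (abs_nonneg _).trans (he i i)
  rw [abs_sub_le_iff]
  constructor
  · let ψ : (Fin N → ℝ) →ₗ[ℝ] (Fin i → ℝ) :=
      LinearMap.pi fun j => dotProductBilin ℝ ℝ (e ⟨j, j.2.trans i.2⟩)
    -- Upper bound: test vectors orthogonal to the directions before i, for which only coefficients
    -- at most θ i survive. An approximate Bessel inequality bounds the sum of squares of the
    -- remaining projections.
    suffices h : eig A i ≤ s * θ i + (b + s * θ i * (k ^ 2 * η)) by linarith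
    refine eig_le hA hi ψ fun x hx => ?_
    have hz : ∀ j : Fin k, j < i → e j ⬝ᵥ x = 0 := fun j hj => congrFun hx ⟨j, hj⟩
    set p : Fin k → ℝ := fun j => e j ⬝ᵥ x with hp
    have hpp : p ⬝ᵥ p ≤ (1 + k ^ 2 * η) * (x ⬝ᵥ x) := by
      have h1 := (abs_le.1 (he.abs_sum_sub_le p)).2
      have h2 : (∑ j, p j • e j) ⬝ᵥ x = p ⬝ᵥ p := by
        rw [sum_dotProduct]
        simp only [smul_dotProduct, smul_eq_mul]
        rfl
      have h3 := dotProduct_sq_le (∑ j, p j • e j) x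
      rw [h2] at h3
      have h4 := dotProduct_self_nonneg' x
      rcases (dotProduct_self_nonneg' p).eq_or_lt with h0 | h0
      · rw [← h0]
        positivity
      · have h5 : (p ⬝ᵥ p) * (p ⬝ᵥ p) ≤ ((1 + k ^ 2 * η) * (x ⬝ᵥ x)) * (p ⬝ᵥ p) := by
          nlinarith
        exact le_of_mul_le_mul_right h5 h0
    have h6 : ∑ j, θ j * (e j ⬝ᵥ x) ^ 2 ≤ θ i * (p ⬝ᵥ p) := by
      rw [dotProduct, Finset.mul_sum]
      refine Finset.sum_le_sum fun j _ => ?_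
      rcases lt_or_ge j i with hj | hj
      · simp [hp, hz j hj]
      · rw [← sq]
        exact mul_le_mul_of_nonneg_right (hθ hj) (sq_nonneg _)
    have h7 := (abs_le.1 (hAb x)).2
    have h8 : s * ∑ j, θ j * (e j ⬝ᵥ x) ^ 2 ≤ s * (θ i * ((1 + k ^ 2 * η) * (x ⬝ᵥ x))) := by
      gcongr
      exact h6.trans (mul_le_mul_of_nonneg_left hpp (hθ0 i))
    linarith
  · have hik : (i : ℕ) + 1 ≤ k := i.2
    let e' : Fin (i + 1) → Fin N → ℝ := fun j => e (Fin.castLE hik j)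
    have he' : IsAlmostOrthonormal η e' := fun j l => by
      have := he (Fin.castLE hik j) (Fin.castLE hik l)
      simpa [Fin.castLE_inj] using this
    have hκ : (((i : ℕ) + 1 : ℕ) : ℝ) ^ 2 * η ≤ k ^ 2 * η := by gcongr
    -- Lower bound: the test space is the span of the first i + 1 directions, where a reverse Bessel
    -- inequality holds.
    let L : (Fin (i + 1) → ℝ) →ₗ[ℝ] (Fin N → ℝ) := Fintype.linearCombination ℝ e'
    have hLc : ∀ c, L c = ∑ j, c j • e' j := fun c => by
      simp [L, Fintype.linearCombination_apply]
    have hlow : ∀ c, (1 - k ^ 2 * η) * (c ⬝ᵥ c) ≤ L c ⬝ᵥ L c := fun c => by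
      have h1 := (abs_le.1 (he'.abs_sum_sub_le c)).1
      rw [← hLc] at h1
      have h2 := mul_le_mul_of_nonneg_right hκ (dotProduct_self_nonneg' c)
      linarith
    suffices h : s * θ i - (b + s * θ i * (k ^ 2 * η)) ≤ eig A i by linarith
    refine le_eig hA hi L (fun c hc => ?_) fun c => ?_
    · have h1 := hlow c
      rw [hc, zero_dotProduct] at h1
      by_contra h0
      nlinarith [dotProduct_self_pos h0]
    · set y := L c with hy
      set p : Fin (i + 1) → ℝ := fun j => e' j ⬝ᵥ y with hp
      have hpp : (1 - k ^ 2 * η) * (y ⬝ᵥ y) ≤ p ⬝ᵥ p := by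
        have hyc : y = ∑ j, c j • e' j := hLc c
        have h2 : c ⬝ᵥ p = y ⬝ᵥ y := by
          calc c ⬝ᵥ p = (∑ j, c j • e' j) ⬝ᵥ y := by
                rw [sum_dotProduct]
                simp only [smul_dotProduct, smul_eq_mul]
                rfl
            _ = y ⬝ᵥ y := by rw [← hyc]
        have h3 := dotProduct_sq_le c p
        rw [h2] at h3
        have h4 := hlow c
        rcases (dotProduct_self_nonneg' c).eq_or_lt with h0 | h0
        · have hc0 : c = 0 := dotProduct_self_eq_zero.1 h0.symm
          have hy0 : y = 0 := by rw [hy, hc0, map_zero]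
          rw [hy0, zero_dotProduct, mul_zero]
          exact dotProduct_self_nonneg' p
        · have h5 : (c ⬝ᵥ c) * ((1 - k ^ 2 * η) * (y ⬝ᵥ y)) ≤ (c ⬝ᵥ c) * (p ⬝ᵥ p) := by
            nlinarith [dotProduct_self_nonneg' y]
          exact le_of_mul_le_mul_left h5 h0
      have h6 : θ i * (p ⬝ᵥ p) ≤ ∑ j, θ j * (e j ⬝ᵥ y) ^ 2 := by
        calc θ i * (p ⬝ᵥ p) = ∑ j : Fin (i + 1), θ i * (p j * p j) := by
              rw [dotProduct, Finset.mul_sum]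
          _ ≤ ∑ j : Fin (i + 1), θ (Fin.castLE hik j) * (e (Fin.castLE hik j) ⬝ᵥ y) ^ 2 := by
              refine Finset.sum_le_sum fun j _ => ?_
              rw [← sq]
              refine mul_le_mul_of_nonneg_right (hθ ?_) (sq_nonneg _)
              rw [Fin.le_def, Fin.val_castLE]
              omega
          _ = ∑ j ∈ Finset.univ.map (Fin.castLEEmb hik), θ j * (e j ⬝ᵥ y) ^ 2 := by
              rw [Finset.sum_map]
              rfl
          _ ≤ _ := Finset.sum_le_univ_sum_of_nonneg fun j =>
              mul_nonneg (hθ0 j) (sq_nonneg _)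
      have h7 := (abs_le.1 (hAb y)).1
      have h8 : s * (θ i * ((1 - k ^ 2 * η) * (y ⬝ᵥ y))) ≤ s * ∑ j, θ j * (e j ⬝ᵥ y) ^ 2 := by
        gcongr
        exact le_trans (mul_le_mul_of_nonneg_left hpp (hθ0 i)) h6
      linarith

/-- The standard basis is exactly orthonormal and there is no perturbation, so the localisation
above is an equality. -/
lemma eig_diagonal {θ : Fin k → ℝ} (hθ : Antitone θ) (hθ0 : ∀ j, 0 ≤ θ j) {s : ℝ} (hs : 0 ≤ s)
    (i : Fin k) : eig (Matrix.diagonal fun j => s * θ j) i = s * θ i := by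
  have h := abs_eig_sub_mul_le (η := 0) (b := 0) (s := s) (e := fun j : Fin k => Pi.single j 1) hθ hθ0
    hs (fun j l => by simp [Pi.single_apply, eq_comm]) (by simp)
    (Matrix.isSymm_diagonal fun j => s * θ j) (fun x => by
      have : x ⬝ᵥ (Matrix.diagonal fun j => s * θ j) *ᵥ x =
          s * ∑ j, θ j * ((Pi.single j 1 : Fin k → ℝ) ⬝ᵥ x) ^ 2 := by
        simp only [dotProduct, mulVec_diagonal, Finset.mul_sum]
        refine Finset.sum_congr rfl fun j _ => ?_
        have : ∑ l, (Pi.single j 1 : Fin k → ℝ) l * x l = x j := single_one_dotProduct j x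
        rw [this]
        ring
      rw [this]
      simp) i i.2
  simp only [mul_zero, add_zero] at h
  exact sub_eq_zero.1 (abs_nonpos_iff.1 h)

/-- The rescaled resolvent of a symmetric matrix above its spectrum. -/
lemma exists_resolvent {W : Matrix (Fin N) (Fin N) ℝ} (hW : W.IsSymm) {μ : ℝ} (hμ : 0 < μ)
    (hWμ : ∀ x, 4 * (W *ᵥ x ⬝ᵥ W *ᵥ x) ≤ μ ^ 2 * (x ⬝ᵥ x)) :
    ∃ S : Matrix (Fin N) (Fin N) ℝ, S.IsSymm ∧ S = 1 + (μ⁻¹ • W) * S ∧ S = 1 + S * (μ⁻¹ • W) ∧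
      ∀ x, S *ᵥ x ⬝ᵥ S *ᵥ x ≤ 4 * (x ⬝ᵥ x) := by
  set T := μ⁻¹ • W with hT
  have hTs : T.IsSymm := hW.smul _
  -- As T contracts norms by at least 1/2, the norm of (1 - T) z is at least half that of z. This
  -- yields both invertibility and the bound on the inverse.
  have hlow : ∀ z, z ⬝ᵥ z ≤ 4 * ((1 - T) *ᵥ z ⬝ᵥ (1 - T) *ᵥ z) := by
    intro z
    have h1 : 4 * (T *ᵥ z ⬝ᵥ T *ᵥ z) ≤ z ⬝ᵥ z := by
      have h2 := hWμ z
      rw [hT, smul_mulVec, smul_dotProduct, dotProduct_smul, smul_eq_mul, smul_eq_mul]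
      have h3 : 0 < μ ^ 2 := by positivity
      refine le_of_mul_le_mul_left ?_ h3
      calc _ = 4 * (W *ᵥ z ⬝ᵥ W *ᵥ z) := by field_simp
        _ ≤ _ := h2
    have h2 := (abs_le.1 (abs_dotProduct_le z (T *ᵥ z) (t := 1 / 2) (by norm_num))).2
    rw [sub_mulVec, one_mulVec, sub_dotProduct, dotProduct_sub, dotProduct_sub,
      dotProduct_comm (T *ᵥ z) z]
    norm_num at h2
    linarith
  have hunit : IsUnit (1 - T) := by
    rw [← Matrix.mulVec_injective_iff_isUnit]
    refine (injective_iff_map_eq_zero (Matrix.mulVecLin (1 - T))).2 fun z hz => ?_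
    have h1 := hlow z
    rw [Matrix.mulVecLin_apply] at hz
    rw [hz, zero_dotProduct, mul_zero] at h1
    exact dotProduct_self_eq_zero.1 (le_antisymm h1 (dotProduct_self_nonneg' z))
  have hdet : IsUnit (1 - T).det := (Matrix.isUnit_iff_isUnit_det _).1 hunit
  have e1 := Matrix.mul_nonsing_inv _ hdet
  have e2 := Matrix.nonsing_inv_mul _ hdet
  refine ⟨(1 - T)⁻¹, ?_, ?_, ?_, fun x => ?_⟩
  · rw [Matrix.IsSymm, Matrix.transpose_nonsing_inv, Matrix.transpose_sub, Matrix.transpose_one,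
      hTs.eq]
  · rw [sub_mul, one_mul] at e1
    exact sub_eq_iff_eq_add.1 e1
  · rw [mul_sub, mul_one] at e2
    exact sub_eq_iff_eq_add.1 e2
  · have := hlow ((1 - T)⁻¹ *ᵥ x)
    rwa [mulVec_mulVec, e1, one_mulVec] at this

/-- Elementary estimates for the terms of the truncated Neumann series. -/
lemma abs_series_le {s μ m ν C₀ a₁ a₂ a₃ r w T d : ℝ} (hs : 1 ≤ s) (hμ : 0 < μ) (hm : 0 < m)
    (hν : 1 ≤ ν) (hμν : μ⁻¹ ≤ ν * s⁻¹) (hmν : m⁻¹ ≤ ν * s⁻¹) (hr : |r| ≤ w) (hT : |T| ≤ C₀ * s)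
    (hd : d = μ⁻¹ * a₁ + μ⁻¹ ^ 2 * a₂ + μ⁻¹ ^ 3 * a₃ + μ⁻¹ ^ 4 * r) :
    |s * d| ≤ ν ^ 4 * (|a₁| + s⁻¹ * |a₂ - T| + s⁻¹ ^ 2 * |a₃| + s⁻¹ ^ 3 * w + C₀) ∧
    |s * d - m⁻¹ ^ 2 * s * T| ≤ ν ^ 4 * (|a₁| + s⁻¹ * |a₂ - T| + s⁻¹ ^ 2 * |a₃| + s⁻¹ ^ 3 * w) +
      2 * C₀ * ν ^ 3 * |μ - m| * s⁻¹ := by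
  have hs0 : 0 < s := by linarith
  set σ := s⁻¹ with hσ
  have hsσ : s * σ = 1 := mul_inv_cancel₀ hs0.ne'
  have hσ0 : 0 < σ := inv_pos.2 hs0
  set p := μ⁻¹ with hp
  have hp0 : 0 < p := inv_pos.2 hμ
  set q := m⁻¹ with hq
  have hq0 : 0 < q := inv_pos.2 hm
  have hν0 : 0 < ν := by linarith
  have hw : 0 ≤ w := (abs_nonneg _).trans hr
  have b1 : s * p ≤ ν ^ 4 := by
    calc s * p ≤ s * (ν * σ) := by gcongr
      _ = ν ^ 1 * (s * σ) := by ring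
      _ ≤ ν ^ 4 := by
          rw [hsσ, mul_one]
          exact pow_le_pow_right₀ hν (by norm_num)
  have b2' : s * p ^ 2 ≤ ν ^ 2 * σ := by
    calc s * p ^ 2 ≤ s * (ν * σ) ^ 2 := by gcongr
      _ = ν ^ 2 * σ * (s * σ) := by ring
      _ = _ := by rw [hsσ, mul_one]
  have b2 : s * p ^ 2 ≤ ν ^ 4 * σ :=
    b2'.trans (mul_le_mul_of_nonneg_right (pow_le_pow_right₀ hν (by norm_num)) hσ0.le)
  have b3 : s * p ^ 3 ≤ ν ^ 4 * σ ^ 2 := by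
    calc s * p ^ 3 ≤ s * (ν * σ) ^ 3 := by gcongr
      _ = ν ^ 3 * σ ^ 2 * (s * σ) := by ring
      _ ≤ ν ^ 4 * σ ^ 2 := by
          rw [hsσ, mul_one]
          exact mul_le_mul_of_nonneg_right (pow_le_pow_right₀ hν (by norm_num)) (by positivity)
  have b4 : s * p ^ 4 ≤ ν ^ 4 * σ ^ 3 := by
    calc s * p ^ 4 ≤ s * (ν * σ) ^ 4 := by gcongr
      _ = ν ^ 4 * σ ^ 3 * (s * σ) := by ring
      _ = _ := by rw [hsσ, mul_one]
  have key : |s * d - p ^ 2 * s * T| ≤ ν ^ 4 * (|a₁| + σ * |a₂ - T| + σ ^ 2 * |a₃| + σ ^ 3 * w) := by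
    have h0 : s * d - p ^ 2 * s * T =
        s * p * a₁ + s * p ^ 2 * (a₂ - T) + s * p ^ 3 * a₃ + s * p ^ 4 * r := by
      rw [hd]
      ring
    rw [h0]
    calc _ ≤ |s * p * a₁| + |s * p ^ 2 * (a₂ - T)| + |s * p ^ 3 * a₃| + |s * p ^ 4 * r| :=
          (abs_add_le _ _).trans (add_le_add_left ((abs_add_le _ _).trans
            (add_le_add_left (abs_add_le _ _) _)) _)
      _ = s * p * |a₁| + s * p ^ 2 * |a₂ - T| + s * p ^ 3 * |a₃| + s * p ^ 4 * |r| := by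
          rw [abs_mul, abs_mul (s * p ^ 2), abs_mul (s * p ^ 3), abs_mul (s * p ^ 4),
            abs_of_pos (show 0 < s * p by positivity), abs_of_pos (show 0 < s * p ^ 2 by positivity),
            abs_of_pos (show 0 < s * p ^ 3 by positivity),
            abs_of_pos (show 0 < s * p ^ 4 by positivity)]
      _ ≤ ν ^ 4 * |a₁| + ν ^ 4 * σ * |a₂ - T| + ν ^ 4 * σ ^ 2 * |a₃| + ν ^ 4 * σ ^ 3 * w := by
          gcongr
      _ = _ := by ring
  constructor
  · have h1 : |p ^ 2 * s * T| ≤ ν ^ 4 * C₀ := by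
      rw [abs_mul, abs_of_pos (show 0 < p ^ 2 * s by positivity)]
      calc p ^ 2 * s * |T| = s * p ^ 2 * |T| := by ring
        _ ≤ ν ^ 4 * σ * (C₀ * s) := by gcongr
        _ = ν ^ 4 * C₀ * (s * σ) := by ring
        _ = _ := by rw [hsσ, mul_one]
    calc |s * d| = |(s * d - p ^ 2 * s * T) + p ^ 2 * s * T| := by rw [sub_add_cancel]
      _ ≤ _ := (abs_add_le _ _).trans (add_le_add key h1)
      _ = _ := by ring
  · have h2 : |(p ^ 2 - q ^ 2) * s * T| ≤ 2 * C₀ * ν ^ 3 * |μ - m| * σ := by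
      -- Both inverses are O(1/s), so p² - q² is O(|μ - m| s⁻³), while the factor multiplying it is
      -- O(s²).
      have h3 : p ^ 2 - q ^ 2 = (m - μ) * (p ^ 2 * q + p * q ^ 2) := by
        rw [hp, hq]
        field_simp
        ring
      have h4 : p ^ 2 * q + p * q ^ 2 ≤ 2 * (ν * σ) ^ 3 := by
        have : p ^ 2 * q ≤ (ν * σ) ^ 2 * (ν * σ) := by gcongr
        have : p * q ^ 2 ≤ (ν * σ) * (ν * σ) ^ 2 := by gcongr
        linarith
      rw [h3, abs_mul, abs_mul, abs_mul, abs_of_pos hs0, abs_sub_comm m μ,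
        abs_of_pos (show 0 < p ^ 2 * q + p * q ^ 2 by positivity)]
      calc |μ - m| * (p ^ 2 * q + p * q ^ 2) * s * |T| ≤
            |μ - m| * (2 * (ν * σ) ^ 3) * s * (C₀ * s) := by gcongr
        _ = 2 * C₀ * ν ^ 3 * |μ - m| * σ * ((s * σ) * (s * σ)) := by ring
        _ = _ := by rw [hsσ]; ring
    calc |s * d - q ^ 2 * s * T| = |(s * d - p ^ 2 * s * T) + (p ^ 2 - q ^ 2) * s * T| := by
          congr 1
          ring
      _ ≤ _ := (abs_add_le _ _).trans (add_le_add key h2)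

end Perturbation

/-! ### Reduction to a k × k matrix and second-order expansion of the isolated eigenvalue. -/

section Isolated

open Matrix

variable {N k : ℕ}

/-- The Neumann identity is iterated four times. Since S commutes with T, the remainder can be
written T² S T², whose quadratic form is controlled by the fourth power of T alone. -/
lemma resolvent_expansion {R : Type*} [Ring R] {S T : R} (h₁ : S = 1 + T * S) (h₂ : S = 1 + S * T) :
    S = 1 + T + T ^ 2 + T ^ 3 + T ^ 2 * S * T ^ 2 := by
  have hc : Commute T S := add_left_cancel (h₁.symm.trans h₂)
  have h4 : S = 1 + T * (1 + T * (1 + T * (1 + T * S))) := by rw [← h₁, ← h₁, ← h₁, ← h₁]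
  have h5 : T ^ 2 * S * T ^ 2 = T ^ 2 * (T ^ 2 * S) := by
    rw [mul_assoc, ← (hc.pow_left 2).eq]
  rw [h5]
  nth_rewrite 1 [h4]
  noncomm_ring

/-- The compression of the resolvent to the leading directions. -/
noncomputable def compression (θ : Fin k → ℝ) (s : ℝ) (e : Fin k → Fin N → ℝ) (S : Matrix (Fin N) (Fin N) ℝ) :
    Matrix (Fin k) (Fin k) ℝ :=
  Matrix.of fun j l => √(θ j * θ l) * s * (e j ⬝ᵥ S *ᵥ e l)

lemma compression_isSymm (θ : Fin k → ℝ) (s : ℝ) (e : Fin k → Fin N → ℝ)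
    {S : Matrix (Fin N) (Fin N) ℝ} (hS : S.IsSymm) : (compression θ s e S).IsSymm := by
  ext j l
  rw [Matrix.transpose_apply, compression, Matrix.of_apply, Matrix.of_apply, mul_comm (θ l),
    dotProduct_mulVec_comm_of_isSymm hS, dotProduct_comm]

/-- An eigenvalue of the full matrix is an eigenvalue of the compressed resolvent. -/
lemma exists_eq_eig_compression {θ : Fin k → ℝ} (hθ : ∀ j, 0 < θ j) {s μ : ℝ} (hμ : μ ≠ 0)
    {e : Fin k → Fin N → ℝ} {W S : Matrix (Fin N) (Fin N) ℝ} (hS : S.IsSymm)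
    (h₂ : S = 1 + S * (μ⁻¹ • W)) {x : Fin N → ℝ} (hx : x ≠ 0)
    (hAx : W *ᵥ x + s • ∑ j, (θ j * (e j ⬝ᵥ x)) • e j = μ • x) :
    ∃ j : Fin k, μ = eig (compression θ s e S) j := by
  set g := s • ∑ j, (θ j * (e j ⬝ᵥ x)) • e j with hg
  -- The eigenvalue equation reads g = μ (1 - W/μ) x, and S inverts 1 - W/μ.
  have hSg : S *ᵥ g = μ • x := by
    have h1 : g = μ • (x - (μ⁻¹ • W) *ᵥ x) := by
      rw [smul_sub, smul_mulVec, smul_smul, mul_inv_cancel₀ hμ, one_smul, ← hAx]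
      abel
    have h3 : S *ᵥ x = x + S *ᵥ ((μ⁻¹ • W) *ᵥ x) := by
      rw [mulVec_mulVec]
      nth_rewrite 1 [h₂]
      rw [add_mulVec, one_mulVec]
    rw [h1, mulVec_smul, mulVec_sub, h3]
    congr 1
    abel
  -- The eigenvector of the compression is the vector of weighted projections of `x`. If it vanished
  -- then so would `g`, hence μ x = S g = 0.
  refine exists_eq_eig_of_eigenvector (compression_isSymm θ s e hS)
    (y := fun j => √(θ j) * (e j ⬝ᵥ x)) (fun h0 => hx ?_) ?_
  · have h1 : ∀ j, e j ⬝ᵥ x = 0 := fun j => by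
      have := congrFun h0 j
      simp only [Pi.zero_apply, mul_eq_zero] at this
      exact this.resolve_left (Real.sqrt_pos.2 (hθ j)).ne'
    have h2 : g = 0 := by
      rw [hg]
      simp [h1]
    rw [h2, mulVec_zero] at hSg
    exact (smul_eq_zero.1 hSg.symm).resolve_left hμ
  · ext j
    have h1 : e j ⬝ᵥ S *ᵥ g = μ * (e j ⬝ᵥ x) := by rw [hSg, dotProduct_smul, smul_eq_mul]
    rw [hg, mulVec_smul, mulVec_sum, dotProduct_smul, dotProduct_sum, smul_eq_mul] at h1
    simp only [mulVec_smul, dotProduct_smul, smul_eq_mul] at h1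
    rw [Pi.smul_apply, smul_eq_mul]
    calc (compression θ s e S *ᵥ fun j => √(θ j) * (e j ⬝ᵥ x)) j =
          ∑ l, √(θ j * θ l) * s * (e j ⬝ᵥ S *ᵥ e l) * (√(θ l) * (e l ⬝ᵥ x)) := rfl
      _ = √(θ j) * (s * ∑ l, θ l * (e l ⬝ᵥ x) * (e j ⬝ᵥ S *ᵥ e l)) := by
          rw [Finset.mul_sum, Finset.mul_sum]
          refine Finset.sum_congr rfl fun l _ => ?_
          rw [Real.sqrt_mul (hθ j).le]
          have := Real.mul_self_sqrt (hθ l).le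
          linear_combination √(θ j) * s * (e j ⬝ᵥ S *ᵥ e l) * (e l ⬝ᵥ x) * this
      _ = _ := by
          rw [h1]
          ring

/-- By monotonicity, separation from the two neighbours separates θ i from every other entry. -/
lemma exists_gap {θ : Fin k → ℝ} (hθ : Antitone θ) (hθ0 : ∀ j, 0 < θ j) {i : Fin k}
    (hi : i ∈ isolated θ) : ∃ g > 0, g ≤ θ i ∧ ∀ j, j ≠ i → g ≤ |θ j - θ i| := by
  have hne : ∀ j, j ≠ i → 0 < |θ j - θ i| := by
    intro j hj
    rw [abs_pos, sub_ne_zero]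
    rcases lt_or_gt_of_ne hj with h | h
    · have h1 : (j : ℕ) < i := h
      have h2 := hi.1 ⟨i - 1, by omega⟩ (by simp; omega)
      have h3 : θ ⟨i - 1, by omega⟩ ≤ θ j := hθ (by rw [Fin.le_def]; simp; omega)
      linarith
    · have h1 : (i : ℕ) < j := h
      have h2 := hi.2 ⟨i + 1, by omega⟩ rfl
      have h3 : θ j ≤ θ ⟨i + 1, by omega⟩ := hθ (by rw [Fin.le_def]; simp; omega)
      linarith
  have h1 : ∀ᶠ g in 𝓝[>] (0 : ℝ), 0 < g := self_mem_nhdsWithin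
  have h2 : ∀ b : ℝ, 0 < b → ∀ᶠ g in 𝓝[>] (0 : ℝ), g ≤ b := fun b hb =>
    nhdsWithin_le_nhds (eventually_le_nhds hb)
  have h3 : ∀ᶠ g in 𝓝[>] (0 : ℝ), ∀ j, j ≠ i → g ≤ |θ j - θ i| := by
    rw [eventually_all]
    intro j
    by_cases hj : j = i
    · exact Eventually.of_forall fun g h => absurd hj h
    · filter_upwards [h2 _ (hne j hj)] with g hg _ using hg
  obtain ⟨g, hg1, hg2, hg3⟩ := (h1.and ((h2 _ (hθ0 i)).and h3)).exists
  exact ⟨g, hg1, hg2, hg3⟩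

/-- One entry of the stochastic error. -/
noncomputable def entryError (s : ℝ) (e : Fin k → Fin N → ℝ) (T : Fin k → Fin k → ℝ)
    (W : Matrix (Fin N) (Fin N) ℝ) (j l : Fin k) : ℝ :=
  |e j ⬝ᵥ (W ^ 1) *ᵥ e l| + s⁻¹ * |e j ⬝ᵥ (W ^ 2) *ᵥ e l - T j l| +
    s⁻¹ ^ 2 * |e j ⬝ᵥ (W ^ 3) *ᵥ e l| +
    s⁻¹ ^ 3 * (e j ⬝ᵥ (W ^ 4) *ᵥ e j + e l ⬝ᵥ (W ^ 4) *ᵥ e l)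

set_option maxHeartbeats 1000000 in
/-- The isolated eigenvalue of a perturbed spectral sum, up to second order. -/
theorem exists_abs_eig_sub_eig_le {θ : Fin k → ℝ} (hθ : Antitone θ) (hθ0 : ∀ j, 0 < θ j) {i : Fin k}
    (hi : i ∈ isolated θ) {C₀ : ℝ} (hC₀ : 0 ≤ C₀) :
    ∃ c > 0, ∃ C, 0 ≤ C ∧ ∀ (N : ℕ) (e : Fin k → Fin N → ℝ) (W A : Matrix (Fin N) (Fin N) ℝ)
      (T : Fin k → Fin k → ℝ) (s η : ℝ), (i : ℕ) < N → 1 ≤ s → W.IsSymm → A.IsSymm →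
      (∀ x, W *ᵥ x ⬝ᵥ W *ᵥ x ≤ (c * s) ^ 2 * (x ⬝ᵥ x)) →
      (∀ x, A *ᵥ x = W *ᵥ x + s • ∑ j, (θ j * (e j ⬝ᵥ x)) • e j) →
      IsAlmostOrthonormal η e → η ≤ c → s * η ≤ C₀ → (∀ j l, |T j l| ≤ C₀ * s) →
      (∀ j l, T j l = T l j) →
      |eig A i - eig (Matrix.of fun j l => √(θ j * θ l) * s * (e j ⬝ᵥ e l) +
          (θ i ^ 2)⁻¹ * √(θ j * θ l) * s⁻¹ * T j l) i| ≤
        C * (s⁻¹ + ∑ j, ∑ l, entryError s e T W j l) := by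
  obtain ⟨g, hg, hgi, hgap⟩ := exists_gap hθ hθ0 hi
  have hθi := hθ0 i
  obtain ⟨Θ, hΘ⟩ : ∃ Θ, ∀ j, θ j ≤ Θ :=
    ⟨∑ j, θ j, fun j => Finset.single_le_sum (fun l _ => (hθ0 l).le) (Finset.mem_univ j)⟩
  have hΘ0 : 0 < Θ := hθi.trans_le (hΘ i)
  have hsqrt : ∀ j l, √(θ j * θ l) ≤ Θ := fun j l => by
    rw [Real.sqrt_le_left hΘ0.le, sq]
    exact mul_le_mul (hΘ j) (hΘ l) (hθ0 l).le hΘ0.le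
  have hk0 : (0 : ℝ) ≤ k := Nat.cast_nonneg k
  -- The bound θ i / 4 keeps ‖W‖ below μ/2, and k² c < 1 keeps the directions independent. The last
  -- two put μ within s g/4 of s θ_i and the compression within s g/4 of the diagonal matrix.
  obtain ⟨c, hc0, hc1, hc2, hc3, hc4, hc5⟩ : ∃ c : ℝ, 0 < c ∧ c ≤ 1 ∧ c ≤ θ i / 4 ∧ k ^ 2 * c < 1 ∧
      c + Θ * (k ^ 2 * c) ≤ g / 4 ∧ k ^ 2 * (Θ * (c + 8 * c / θ i)) ≤ g / 4 := by
    have h1 : ∀ᶠ c in 𝓝[>] (0 : ℝ), 0 < c := self_mem_nhdsWithin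
    have h2 : ∀ a b : ℝ, 0 < b → ∀ᶠ c in 𝓝[>] (0 : ℝ), a * c < b := fun a b hb => by
      refine nhdsWithin_le_nhds ?_
      have : Tendsto (fun c : ℝ => a * c) (𝓝 0) (𝓝 (a * 0)) := tendsto_id.const_mul a
      rw [mul_zero] at this
      exact this.eventually (eventually_lt_nhds hb)
    obtain ⟨c, hc, h3, h4, h5, h6, h7⟩ := (h1.and ((h2 1 1 one_pos).and ((h2 1 (θ i / 4)
      (by positivity)).and ((h2 (k ^ 2) 1 one_pos).and ((h2 (1 + Θ * k ^ 2) (g / 4)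
      (by positivity)).and (h2 (k ^ 2 * (Θ * (1 + 8 / θ i))) (g / 4)
      (by positivity))))))).exists
    refine ⟨c, hc, by linarith, by linarith, h5, by linarith, ?_⟩
    calc _ = k ^ 2 * (Θ * (1 + 8 / θ i)) * c := by ring
      _ ≤ _ := h7.le
  set ν : ℝ := max 1 (2 / θ i) with hν
  have hν1 : 1 ≤ ν := le_max_left _ _
  have hν2 : 2 / θ i ≤ ν := le_max_right _ _
  refine ⟨c, hc0, Θ * ν ^ 4 + k ^ 2 * Θ * (2 * C₀ * ν ^ 3) *
    (k ^ 2 * Θ * ((ν ^ 4 + 1) * C₀) + Θ * ν ^ 4), by positivity, ?_⟩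
  intro N e W A T s η hiN hs hW hA hWn hAx he hηc hsη hT hTs
  have hs0 : 0 < s := by linarith
  have hη0 : 0 ≤ η := (abs_nonneg _).trans (he i i)
  set μ := eig A i with hμdef
  have hWq : ∀ x, |x ⬝ᵥ W *ᵥ x| ≤ c * s * (x ⬝ᵥ x) := fun x => by
    have hx := dotProduct_self_nonneg' x
    refine abs_le_of_sq_le_sq ((dotProduct_sq_le _ _).trans ?_) (by positivity)
    nlinarith [mul_le_mul_of_nonneg_left (hWn x) hx]
  -- crude localisation
  have hμ1 : |μ - s * θ i| ≤ s * (g / 4) := by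
    have h1 := abs_eig_sub_mul_le (b := c * s) hθ (fun j => (hθ0 j).le) hs0.le he
      (lt_of_le_of_lt (by gcongr) hc3) hA (fun x => by
        have h2 : x ⬝ᵥ A *ᵥ x - s * ∑ j, θ j * (e j ⬝ᵥ x) ^ 2 = x ⬝ᵥ W *ᵥ x := by
          rw [hAx, dotProduct_add, dotProduct_smul, dotProduct_sum, smul_eq_mul]
          simp only [dotProduct_smul, smul_eq_mul, dotProduct_comm x (e _)]
          have : ∑ j, θ j * (e j ⬝ᵥ x) * (e j ⬝ᵥ x) = ∑ j, θ j * (e j ⬝ᵥ x) ^ 2 :=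
            Finset.sum_congr rfl fun j _ => by ring
          rw [this]
          ring
        rw [h2]
        exact hWq x) i hiN
    refine h1.trans ?_
    have h3 : s * θ i * (k ^ 2 * η) ≤ s * (Θ * (k ^ 2 * c)) := by
      rw [mul_assoc]
      gcongr
      exact hΘ i
    nlinarith
  have hμs : s * (θ i / 2) ≤ μ := by
    have h1 := (abs_le.1 hμ1).1
    nlinarith
  have hμ0 : 0 < μ := lt_of_lt_of_le (by positivity) hμs
  have hμν : μ⁻¹ ≤ ν * s⁻¹ := by
    calc μ⁻¹ ≤ (s * (θ i / 2))⁻¹ := inv_anti₀ (by positivity) hμs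
      _ = 2 / θ i * s⁻¹ := by field_simp
      _ ≤ _ := by gcongr
  set m := s * θ i with hm
  have hm0 : 0 < m := by positivity
  have hmν : m⁻¹ ≤ ν * s⁻¹ := by
    refine le_trans (inv_anti₀ (b := s * (θ i / 2)) (by positivity) (by rw [hm]; nlinarith)) ?_
    calc (s * (θ i / 2))⁻¹ = 2 / θ i * s⁻¹ := by field_simp
      _ ≤ _ := by gcongr
  have hcsμ : 2 * (c * s) ≤ μ := by nlinarith
  obtain ⟨S, hS, hS1, hS2, hS3⟩ := exists_resolvent hW hμ0 (fun x => by
    have hx := dotProduct_self_nonneg' x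
    have h1 : (2 * (c * s)) ^ 2 ≤ μ ^ 2 := by gcongr
    nlinarith [hWn x, mul_le_mul_of_nonneg_right h1 hx])
  obtain ⟨x, hx0, hx⟩ := exists_eigenvector hA hiN
  rw [hAx] at hx
  obtain ⟨j₀, hj₀⟩ := exists_eq_eig_compression hθ0 hμ0.ne' hS hS2 hx0 hx
  set K := compression θ s e S with hK
  have hKs : K.IsSymm := compression_isSymm θ s e hS
  set d : Fin k → Fin k → ℝ := fun j l => e j ⬝ᵥ S *ᵥ e l - e j ⬝ᵥ e l with hd
  -- the compressed resolvent is close to the diagonal matrix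
  set D : Matrix (Fin k) (Fin k) ℝ := Matrix.diagonal fun j => s * θ j with hD
  have hDs : D.IsSymm := Matrix.isSymm_diagonal _
  have hKD : ∀ j l, |K j l - D j l| ≤ Θ * (|s * d j l| + s * η) := by
    intro j l
    have h1 : D j l = √(θ j * θ l) * (s * if j = l then 1 else 0) := by
      rw [hD, Matrix.diagonal_apply]
      split_ifs with h
      · rw [h, Real.sqrt_mul_self (hθ0 l).le]
        ring
      · simp
    have h2 : K j l - D j l = √(θ j * θ l) *
        (s * d j l + s * (e j ⬝ᵥ e l - if j = l then 1 else 0)) := by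
      rw [h1, hK, compression, Matrix.of_apply, hd]
      ring
    rw [h2, abs_mul, abs_of_nonneg (Real.sqrt_nonneg _)]
    refine mul_le_mul (hsqrt j l) ((abs_add_le _ _).trans ?_) (abs_nonneg _) hΘ0.le
    gcongr
    rw [abs_mul, abs_of_pos hs0]
    gcongr
    exact he j l
  have hee : ∀ j, e j ⬝ᵥ e j ≤ 2 := fun j => by
    have := (abs_le.1 (he j j)).2
    rw [if_pos rfl] at this
    linarith
  have hd1 : ∀ j l, |d j l| ≤ 8 * c / θ i := by
    intro j l
    have h1 : d j l = μ⁻¹ * (W *ᵥ e j ⬝ᵥ S *ᵥ e l) := by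
      rw [hd]
      change e j ⬝ᵥ S *ᵥ e l - e j ⬝ᵥ e l = _
      nth_rewrite 1 [hS1]
      rw [add_mulVec, one_mulVec, dotProduct_add, add_sub_cancel_left, smul_mul_assoc, smul_mulVec,
        dotProduct_smul, smul_eq_mul, ← mulVec_mulVec, dotProduct_mulVec_comm_of_isSymm hW]
    have h2 : |W *ᵥ e j ⬝ᵥ S *ᵥ e l| ≤ 4 * (c * s) := by
      refine abs_le_of_sq_le_sq ((dotProduct_sq_le _ _).trans ?_) (by positivity)
      have h3 : W *ᵥ e j ⬝ᵥ W *ᵥ e j ≤ (c * s) ^ 2 * 2 := (hWn _).trans (by gcongr; exact hee j)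
      have h4 : S *ᵥ e l ⬝ᵥ S *ᵥ e l ≤ 4 * 2 := (hS3 _).trans (by gcongr; exact hee l)
      calc _ ≤ (c * s) ^ 2 * 2 * (4 * 2) :=
            mul_le_mul h3 h4 (dotProduct_self_nonneg' _) (by positivity)
        _ = _ := by ring
    rw [h1, abs_mul, abs_of_pos (inv_pos.2 hμ0)]
    calc μ⁻¹ * |W *ᵥ e j ⬝ᵥ S *ᵥ e l| ≤ (s * (θ i / 2))⁻¹ * (4 * (c * s)) := by
          gcongr
      _ = _ := by
          field_simp
          ring
  -- Otherwise s θ_{j₀} and s θ_i would both lie within s g/4 of μ, although they are at least s g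
  -- apart.
  have hj₀i : j₀ = i := by
    by_contra hne
    have h1 := abs_eig_sub_eig_le hKs hDs j₀.2
    rw [← hj₀, eig_diagonal hθ (fun j => (hθ0 j).le) hs0.le] at h1
    have h2 : ∑ j, ∑ l, |K j l - D j l| ≤ s * (g / 4) := by
      calc _ ≤ ∑ j : Fin k, ∑ l : Fin k, Θ * (s * (8 * c / θ i) + s * c) := by
            refine Finset.sum_le_sum fun j _ => Finset.sum_le_sum fun l _ => (hKD j l).trans ?_
            rw [abs_mul, abs_of_pos hs0]
            gcongr
            exact hd1 j l
        _ = s * (k ^ 2 * (Θ * (c + 8 * c / θ i))) := by simp; ring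
        _ ≤ _ := by gcongr
    have h3 := h1.trans h2
    have h4 : s * g ≤ s * |θ j₀ - θ i| := by gcongr; exact hgap j₀ hne
    have h5 : s * |θ j₀ - θ i| = |(μ - m) - (μ - s * θ j₀)| := by
      rw [← abs_of_pos hs0, ← abs_mul, abs_of_pos hs0, hm]
      congr 1
      ring
    have h6 := abs_sub (μ - m) (μ - s * θ j₀)
    nlinarith
  rw [hj₀i] at hj₀
  -- expansion of the resolvent
  set R := entryError s e T W with hR
  have hdexp : ∀ j l, |s * d j l| ≤ ν ^ 4 * (R j l + C₀) ∧
      |s * d j l - m⁻¹ ^ 2 * s * T j l| ≤ ν ^ 4 * R j l + 2 * C₀ * ν ^ 3 * |μ - m| * s⁻¹ := by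
    intro j l
    have hW2 : (W ^ 2).IsSymm := by rw [Matrix.IsSymm, Matrix.transpose_pow, hW.eq]
    have hW4 : ∀ j, e j ⬝ᵥ (W ^ 4) *ᵥ e j = (W ^ 2) *ᵥ e j ⬝ᵥ (W ^ 2) *ᵥ e j := fun j => by
      rw [← dotProduct_mulVec_comm_of_isSymm hW2, mulVec_mulVec, ← pow_add]
    have hr : |(W ^ 2) *ᵥ e j ⬝ᵥ S *ᵥ ((W ^ 2) *ᵥ e l)| ≤
        e j ⬝ᵥ (W ^ 4) *ᵥ e j + e l ⬝ᵥ (W ^ 4) *ᵥ e l := by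
      have h1 := abs_dotProduct_le ((W ^ 2) *ᵥ e j) (S *ᵥ ((W ^ 2) *ᵥ e l)) two_pos
      have h2 := hS3 ((W ^ 2) *ᵥ e l)
      rw [hW4, hW4]
      linarith
    refine abs_series_le hs hμ0 hm0 hν1 hμν hmν hr (hT j l) ?_
    rw [hd]
    change e j ⬝ᵥ S *ᵥ e l - e j ⬝ᵥ e l = _
    nth_rewrite 1 [resolvent_expansion hS1 hS2]
    simp only [smul_pow, smul_mul_assoc, mul_smul_comm, add_mulVec, one_mulVec, smul_mulVec,
      dotProduct_add, dotProduct_smul, smul_eq_mul, pow_one, smul_smul]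
    rw [← mulVec_mulVec, ← mulVec_mulVec,
      dotProduct_mulVec_comm_of_isSymm hW2 (e j) (S *ᵥ ((W ^ 2) *ᵥ e l))]
    ring
  have hR0 : ∀ j l, 0 ≤ R j l := fun j l => by
    have hW4 : ∀ j, 0 ≤ e j ⬝ᵥ (W ^ 4) *ᵥ e j := fun j => by
      have hW2 : (W ^ 2).IsSymm := by rw [Matrix.IsSymm, Matrix.transpose_pow, hW.eq]
      have : e j ⬝ᵥ (W ^ 4) *ᵥ e j = (W ^ 2) *ᵥ e j ⬝ᵥ (W ^ 2) *ᵥ e j := by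
        rw [← dotProduct_mulVec_comm_of_isSymm hW2, mulVec_mulVec, ← pow_add]
      rw [this]
      exact dotProduct_self_nonneg' _
    have := hW4 j
    have := hW4 l
    rw [hR, entryError]
    positivity
  have hsum0 : 0 ≤ ∑ j, ∑ l, R j l :=
    Finset.sum_nonneg fun j _ => Finset.sum_nonneg fun l _ => hR0 j l
  -- A priori bound from the crude half of the expansion. Divided by s below, it pays for putting s
  -- θ_i in place of μ in the second-order term.
  have hρ : |μ - m| ≤ k ^ 2 * Θ * ((ν ^ 4 + 1) * C₀) + Θ * ν ^ 4 * ∑ j, ∑ l, R j l := by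
    have h1 := abs_eig_sub_eig_le hKs hDs i.2
    rw [← hj₀, eig_diagonal hθ (fun j => (hθ0 j).le) hs0.le] at h1
    refine h1.trans ?_
    calc _ ≤ ∑ j : Fin k, ∑ l : Fin k, (Θ * ((ν ^ 4 + 1) * C₀) + Θ * ν ^ 4 * R j l) := by
          refine Finset.sum_le_sum fun j _ => Finset.sum_le_sum fun l _ => (hKD j l).trans ?_
          calc _ ≤ Θ * (ν ^ 4 * (R j l + C₀) + C₀) := by
                gcongr
                exact (hdexp j l).1
            _ = _ := by ring
      _ = _ := by
          simp only [Finset.sum_add_distrib, ← Finset.mul_sum, Finset.sum_const, Finset.card_univ,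
            Fintype.card_fin, nsmul_eq_mul]
          ring
  set B : Matrix (Fin k) (Fin k) ℝ := Matrix.of fun j l => √(θ j * θ l) * s * (e j ⬝ᵥ e l) +
          (θ i ^ 2)⁻¹ * √(θ j * θ l) * s⁻¹ * T j l with hB
  have hBs : B.IsSymm := by
    ext j l
    rw [Matrix.transpose_apply, hB, Matrix.of_apply, Matrix.of_apply, mul_comm (θ l),
      dotProduct_comm, hTs]
  -- The factor θ_i⁻² s⁻¹ of the second-order term of `B` is s (s θ_i)⁻². The Gram entries are kept
  -- exactly, so their defect does not enter here.
  have hKB : ∀ j l, |K j l - B j l| ≤ Θ * (ν ^ 4 * R j l + 2 * C₀ * ν ^ 3 * |μ - m| * s⁻¹) := by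
    intro j l
    have h2 : K j l - B j l = √(θ j * θ l) * (s * d j l - m⁻¹ ^ 2 * s * T j l) := by
      rw [hK, compression, hB, Matrix.of_apply, Matrix.of_apply, hd, hm]
      field_simp
      ring
    rw [h2, abs_mul, abs_of_nonneg (Real.sqrt_nonneg _)]
    exact mul_le_mul (hsqrt j l) (hdexp j l).2 (abs_nonneg _) hΘ0.le
  have hfin := abs_eig_sub_eig_le hKs hBs i.2
  rw [← hj₀] at hfin
  have hsi0 : 0 < s⁻¹ := inv_pos.2 hs0
  have hsi1 : s⁻¹ ≤ 1 := inv_le_one_of_one_le₀ hs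
  set Rs := ∑ j, ∑ l, R j l with hRs
  have h9 : |μ - m| * s⁻¹ ≤ (k ^ 2 * Θ * ((ν ^ 4 + 1) * C₀) + Θ * ν ^ 4) * (s⁻¹ + Rs) := by
    set a := k ^ 2 * Θ * ((ν ^ 4 + 1) * C₀) with ha
    set b := Θ * ν ^ 4 with hb
    have ha0 : 0 ≤ a := by positivity
    have hb0 : 0 ≤ b := by positivity
    calc |μ - m| * s⁻¹ ≤ (a + b * Rs) * s⁻¹ := by gcongr
      _ = a * s⁻¹ + b * Rs * s⁻¹ := by ring
      _ ≤ a * s⁻¹ + b * Rs * 1 := by gcongr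
      _ ≤ (a + b) * (s⁻¹ + Rs) := by nlinarith [mul_nonneg ha0 hsum0, mul_nonneg hb0 hsi0.le]
  calc |μ - eig B i| ≤ ∑ j, ∑ l, |K j l - B j l| := hfin
    _ ≤ ∑ j, ∑ l, Θ * (ν ^ 4 * R j l + 2 * C₀ * ν ^ 3 * |μ - m| * s⁻¹) :=
        Finset.sum_le_sum fun j _ => Finset.sum_le_sum fun l _ => hKB j l
    _ = Θ * ν ^ 4 * Rs + k ^ 2 * Θ * (2 * C₀ * ν ^ 3) * (|μ - m| * s⁻¹) := by
        simp only [mul_add, Finset.sum_add_distrib, ← Finset.mul_sum, Finset.sum_const,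
          Finset.card_univ, Fintype.card_fin, nsmul_eq_mul, hRs]
        ring
    _ ≤ Θ * ν ^ 4 * (s⁻¹ + Rs) + k ^ 2 * Θ * (2 * C₀ * ν ^ 3) *
          ((k ^ 2 * Θ * ((ν ^ 4 + 1) * C₀) + Θ * ν ^ 4) * (s⁻¹ + Rs)) := by
        exact add_le_add (mul_le_mul_of_nonneg_left (by linarith) (by positivity))
          (mul_le_mul_of_nonneg_left h9 (by positivity))
    _ = _ := by ring

end Isolated

/-! ### Consequences of the moment bounds -/

section Consequences

open Matrix

variable {N : ℕ}

lemma trace_pow_two_mul_eq {W : Matrix (Fin N) (Fin N) ℝ} (hW : W.IsSymm) (m : ℕ) :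
    (W ^ (2 * m)).trace = ∑ a, ((W ^ m) a ⬝ᵥ (W ^ m) a) := by
  have h : (W ^ m)ᵀ = W ^ m := by rw [Matrix.transpose_pow, hW.eq]
  rw [two_mul, pow_add, Matrix.trace]
  refine Finset.sum_congr rfl fun a _ => ?_
  rw [Matrix.diag_apply, Matrix.mul_apply, dotProduct]
  exact Finset.sum_congr rfl fun c _ => congrArg _ (congrFun (congrFun h a) c)

lemma trace_pow_two_mul_nonneg {W : Matrix (Fin N) (Fin N) ℝ} (hW : W.IsSymm) (m : ℕ) :
    0 ≤ (W ^ (2 * m)).trace := by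
  rw [trace_pow_two_mul_eq hW]
  exact Finset.sum_nonneg fun _ _ => dotProduct_self_nonneg' _

/-- A bound for the trace of a high even power bounds the operator norm. -/
lemma mulVec_dotProduct_self_le_of_trace_le {W : Matrix (Fin N) (Fin N) ℝ} (hW : W.IsSymm) {m : ℕ}
    (hm : m ≠ 0) {b : ℝ} (h : (W ^ (2 * m)).trace ≤ b ^ (2 * m)) (x : Fin N → ℝ) :
    W *ᵥ x ⬝ᵥ W *ᵥ x ≤ b ^ 2 * (x ⬝ᵥ x) := by
  obtain ⟨v, hv, hp, -, hn⟩ := exists_eigenbasis hW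
  have hpow : ∀ j, ∀ n : ℕ, (W ^ n) *ᵥ v j = eig W j ^ n • v j := fun j n => by
    induction n with
    | zero => simp
    | succ n ih => rw [pow_succ, ← mulVec_mulVec, hv, mulVec_smul, ih, smul_smul, pow_succ']
  have hle : ∀ j : Fin N, eig W j ^ 2 ≤ b ^ 2 := fun j => by
    have h1 : (eig W j ^ 2) ^ m ≤ (b ^ 2) ^ m := by
      rw [← pow_mul, ← pow_mul]
      refine le_trans ?_ h
      rw [trace_pow_two_mul_eq hW]
      -- This equals the squared norm of W^m v_j, at most the sum of the squared norms of the rows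
      -- of W^m, which is the trace.
      have h2 : eig W j ^ (2 * m) = ((W ^ m) *ᵥ v j) ⬝ᵥ ((W ^ m) *ᵥ v j) := by
        rw [hpow, smul_dotProduct, dotProduct_smul, hn, smul_eq_mul, smul_eq_mul]
        ring
      rw [h2]
      refine Finset.sum_le_sum fun a _ => ?_
      have h3 := dotProduct_sq_le ((W ^ m) a) (v j)
      rw [hn, mul_one, sq] at h3
      exact h3
    exact (pow_le_pow_iff_left₀ (sq_nonneg _) (sq_nonneg _) hm).1 h1
  rw [hp (W *ᵥ x), hp x, Finset.mul_sum]
  refine Finset.sum_le_sum fun j _ => ?_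
  rw [dotProduct_mulVec_comm_of_isSymm hW, hv, smul_dotProduct, smul_eq_mul]
  nlinarith [mul_le_mul_of_nonneg_right (hle j) (mul_self_nonneg (v j ⬝ᵥ x))]

variable {Ω : Type*} [MeasurableSpace Ω] {P : Measure Ω} [IsProbabilityMeasure P]

/-- Integrates the pointwise inequality |Z| ≤ Z²/(2τ) + τ/2. -/
lemma integral_abs_le_of_integral_sq_le {Z : Ω → ℝ} (hZ : Integrable Z P)
    (hZ2 : Integrable (fun ω => Z ω ^ 2) P) {τ : ℝ} (hτ : 0 < τ) (h : ∫ ω, Z ω ^ 2 ∂P ≤ τ ^ 2) :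
    ∫ ω, |Z ω| ∂P ≤ τ := by
  have h1 : ∀ ω, |Z ω| ≤ (2 * τ)⁻¹ * Z ω ^ 2 + τ / 2 := fun ω => by
    rw [← sq_abs (Z ω)]
    have : (2 * τ)⁻¹ * |Z ω| ^ 2 + τ / 2 - |Z ω| = (2 * τ)⁻¹ * (|Z ω| - τ) ^ 2 := by
      field_simp
      ring
    have h2 : 0 ≤ (2 * τ)⁻¹ * (|Z ω| - τ) ^ 2 := by positivity
    linarith
  calc _ ≤ ∫ ω, ((2 * τ)⁻¹ * Z ω ^ 2 + τ / 2) ∂P :=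
        integral_mono hZ.abs ((hZ2.const_mul _).add (integrable_const _)) h1
    _ = (2 * τ)⁻¹ * ∫ ω, Z ω ^ 2 ∂P + τ / 2 := by
        rw [integral_add (hZ2.const_mul _) (integrable_const _), integral_const_mul, integral_const]
        simp
    _ ≤ (2 * τ)⁻¹ * τ ^ 2 + τ / 2 := by gcongr
    _ = τ := by field_simp; ring

variable {δ : ℝ} {X : Sym2 (Fin N) → Ω → ℝ}

namespace IsCentredFamily

/-- High moments of the operator norm are negligible at any scale above the natural one. -/
lemma integral_trace_div_le (hX : IsCentredFamily P δ X) (hδ : 0 < δ) {m : ℕ} (hN : 0 < N)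
    (hm : (2 * m + 1 : ℝ) ≤ N * δ) {b : ℝ} (hb : 0 < b)
    (h4 : 4 * (2 * m + 1) * (N * δ) ≤ Real.exp (-4) * b ^ 2) (hlog : Real.log N ≤ m) :
    ∫ ω, (symMatrix X ω ^ (2 * m)).trace ∂P ≤ b ^ (2 * m) * (N : ℝ)⁻¹ ^ 3 := by
  have hN0 : (0 : ℝ) < N := Nat.cast_pos.2 hN
  set κ : ℝ := N * δ with hκ
  have hκ0 : 0 < κ := by positivity
  have hm0 : (0 : ℝ) < 2 * m + 1 := by positivity
  -- With this t a fresh edge costs N δ t = 2m + 1, the same as the number of vertices available for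
  -- a return.
  have h1 := (hX.integral_trace_pow_le hδ.le (t := (2 * m + 1) / κ) (by positivity)
    ((div_le_one hκ0).2 hm) (2 * m)).2
  refine h1.trans ?_
  have h2 : (Fintype.card (Fin N) : ℝ) * (δ * ((2 * m + 1) / κ)) = 2 * m + 1 := by
    rw [Fintype.card_fin, hκ]
    field_simp
  rw [h2, Nat.mul_div_cancel_left m two_pos, Fintype.card_fin]
  push_cast
  have h3 : ((2 * m + 1) / κ)⁻¹ ^ m * (N * (2 * m + 1 + (2 * (m : ℝ) + 1)) ^ (2 * m)) =
      N * (4 * (2 * m + 1) * κ) ^ m := by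
    rw [pow_mul]
    have : ((2 * m + 1) / κ)⁻¹ ^ m * (N * ((2 * m + 1 + (2 * (m : ℝ) + 1)) ^ 2) ^ m) =
        N * (((2 * m + 1) / κ)⁻¹ * (2 * m + 1 + (2 * (m : ℝ) + 1)) ^ 2) ^ m := by
      rw [mul_pow]
      ring
    rw [this]
    congr 2
    field_simp
    ring
  rw [h3]
  -- Since m ≥ log N. One of the four powers of N is spent on the choice of the starting vertex.
  have h5 : Real.exp (-4) ^ m ≤ (N : ℝ)⁻¹ ^ 4 := by
    rw [← Real.exp_nat_mul, ← Real.exp_log hN0, ← Real.exp_neg, ← Real.exp_nat_mul]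
    apply Real.exp_le_exp.2
    push_cast
    linarith
  calc N * (4 * (2 * m + 1) * κ) ^ m ≤ N * (Real.exp (-4) * b ^ 2) ^ m := by gcongr
    _ = N * (Real.exp (-4) ^ m * b ^ (2 * m)) := by rw [mul_pow, pow_mul]
    _ ≤ N * ((N : ℝ)⁻¹ ^ 4 * b ^ (2 * m)) := by gcongr
    _ = _ := by field_simp

variable {K : ℝ} {u v : Fin N → ℝ}

lemma integral_dotProduct_pow_one (hX : IsCentredFamily P δ X) (u v : Fin N → ℝ) :
    ∫ ω, u ⬝ᵥ (symMatrix X ω ^ 1) *ᵥ v ∂P = 0 := by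
  simp_rw [dotProduct_symMatrix_pow_mulVec]
  rw [integral_finsetSum _ fun p _ => (hX.integrable_edgeProd _).const_mul _]
  refine Finset.sum_eq_zero fun p _ => ?_
  rw [integral_const_mul]
  simp [edgeProd, hX.mean]

/-- Expectations of quadratic forms of powers, for delocalised vectors. -/
lemma abs_integral_dotProduct_pow_le_of_delocalised (hX : IsCentredFamily P δ X) (hδ : 0 < δ)
    (hN : 0 < N) (hNδ : 1 ≤ N * δ) (hu : ∀ a, |u a| ≤ (√N)⁻¹ * K) (hv : ∀ a, |v a| ≤ (√N)⁻¹ * K)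
    (hK : 0 ≤ K) (n : ℕ) :
    |∫ ω, u ⬝ᵥ (symMatrix X ω ^ n) *ᵥ v ∂P| ≤ K ^ 2 * (n + 2) ^ n * (N * δ) ^ (n / 2) := by
  have hN0 : (0 : ℝ) < N := Nat.cast_pos.2 hN
  -- With t = 1/(N δ), choosing a fresh edge costs N δ t = 1 in total, and the factor N from the
  -- starting vertex cancels the N⁻¹ from the two delocalised vectors.
  have h := hX.abs_integral_dotProduct_pow_le hδ.le (t := (N * δ)⁻¹) (by positivity)
    (inv_le_one_of_one_le₀ hNδ) hu hv (by positivity) (by positivity) n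
  refine h.trans (le_of_eq ?_)
  have h1 : (Fintype.card (Fin N) : ℝ) * (δ * (N * δ)⁻¹) = 1 := by
    rw [Fintype.card_fin]
    field_simp
  have h2 : (√N)⁻¹ * K * ((√N)⁻¹ * K) = K ^ 2 * (N : ℝ)⁻¹ := by
    have := Real.mul_self_sqrt hN0.le
    calc _ = K ^ 2 * (√N * √N)⁻¹ := by ring
      _ = _ := by rw [this]
  rw [h1, h2, inv_inv, Fintype.card_fin]
  have h3 : (1 + ((n : ℝ) + 1)) = n + 2 := by ring
  rw [h3]
  field_simp

/-- Variances of quadratic forms of powers, for delocalised vectors. -/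
lemma variance_dotProduct_pow_le_of_delocalised (hX : IsCentredFamily P δ X) (hδ : 0 < δ)
    (hN : 0 < N) (hNδ : 1 ≤ N * δ) (hu : ∀ a, |u a| ≤ (√N)⁻¹ * K) (hv : ∀ a, |v a| ≤ (√N)⁻¹ * K)
    (hK : 0 ≤ K) (n : ℕ) :
    ∫ ω, (u ⬝ᵥ (symMatrix X ω ^ n) *ᵥ v - ∫ ω', u ⬝ᵥ (symMatrix X ω' ^ n) *ᵥ v ∂P) ^ 2 ∂P ≤
      K ^ 4 * (2 * (n + 1) ^ 2 * (2 * n + 2) ^ n * (n + 2) ^ n) * ((N * δ) ^ n * (N : ℝ)⁻¹) := by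
  have hN0 : (0 : ℝ) < N := Nat.cast_pos.2 hN
  have h0 : δ * (N * δ)⁻¹ = (N : ℝ)⁻¹ := by field_simp
  have h := hX.variance_dotProduct_pow_le hδ.le (t := (N * δ)⁻¹) (by positivity)
    (inv_le_one_of_one_le₀ hNδ) (by
      rw [h0]
      exact inv_le_one_of_one_le₀ (by exact_mod_cast hN)) hu hv (by positivity) (by positivity) n
  refine h.trans (le_of_eq ?_)
  have h1 : (Fintype.card (Fin N) : ℝ) * (δ * (N * δ)⁻¹) = 1 := by
    rw [Fintype.card_fin]
    field_simp
  have h2 : (√N)⁻¹ * K * ((√N)⁻¹ * K) = K ^ 2 * (N : ℝ)⁻¹ := by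
    have := Real.mul_self_sqrt hN0.le
    calc _ = K ^ 2 * (√N * √N)⁻¹ := by ring
      _ = _ := by rw [this]
  rw [h1, h2, inv_inv, Fintype.card_fin]
  have h3 : (1 + ((n : ℝ) + 1)) = n + 2 := by ring
  have h4 : (1 + (2 * (n : ℝ) + 1)) = 2 * n + 2 := by ring
  rw [h3, h4]
  field_simp

end IsCentredFamily

end Consequences

/-! ### The random graph model -/

section Model

open Matrix

variable {Ω : Type*} [MeasurableSpace Ω] {P : Measure Ω}

namespace IsBernoulli

variable {X : Ω → ℝ} {p : ℝ}

lemma aemeasurable (h : IsBernoulli X p P) : AEMeasurable X P := by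
  obtain ⟨q, -, hq⟩ := h
  exact hq.aemeasurable

lemma ae_eq_or (h : IsBernoulli X p P) : ∀ᵐ ω ∂P, X ω = 1 ∨ X ω = 0 := by
  obtain ⟨q, -, hq⟩ := h
  have hm : MeasurableSet {x : ℝ | x = 1 ∨ x = 0} :=
    (measurableSet_singleton 1).union (measurableSet_singleton 0)
  rw [hq.ae_iff (p := fun x => x = 1 ∨ x = 0) (measurableSet_setOfPred.1 hm), ae_iff]
  exact bernoulliMeasure_apply_of_notMem_of_notMem q hm.compl (by simp) (by simp)

lemma integral_comp (h : IsBernoulli X p P) {g : ℝ → ℝ} (hg : Measurable g) :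
    ∫ ω, g (X ω) ∂P = p * g 1 + (1 - p) * g 0 := by
  obtain ⟨q, hqp, hq⟩ := h
  have := hq.integral_comp hg.aestronglyMeasurable
  rw [integral_bernoulliMeasure, hqp] at this
  exact this

lemma mem_Icc (h : IsBernoulli X p P) : p ∈ Set.Icc (0 : ℝ) 1 := by
  obtain ⟨q, hqp, -⟩ := h
  exact hqp ▸ q.2

lemma integral_eq (h : IsBernoulli X p P) : ∫ ω, X ω ∂P = p := by
  simpa using h.integral_comp measurable_id

end IsBernoulli

lemma grid_mem_Icc {N : ℕ} (a : Fin N) : ((a : ℝ) + 1) / N ∈ Set.Icc (0 : ℝ) 1 := by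
  have h : ((a : ℝ) + 1) ≤ N := by exact_mod_cast a.2
  exact ⟨by positivity, div_le_one_of_le₀ h (Nat.cast_nonneg N)⟩

/-- Edge probability. -/
noncomputable def edgeProb (N : ℕ) (ε : ℝ) (f : ℝ → ℝ → ℝ) (a b : Fin N) : ℝ :=
  ε * f (((a : ℝ) + 1) / N) (((b : ℝ) + 1) / N)

namespace IsAdjacency

variable {N : ℕ} {ε : ℝ} {f : ℝ → ℝ → ℝ} {A : Ω → Matrix (Fin N) (Fin N) ℝ}

lemma isBernoulli (hA : IsAdjacency P N ε f A)
    (hf : ∀ x ∈ Set.Icc (0 : ℝ) 1, ∀ y ∈ Set.Icc (0 : ℝ) 1, f x y = f y x) (a b : Fin N) :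
    IsBernoulli (fun ω => A ω a b) (edgeProb N ε f a b) P := by
  rcases le_total a b with h | h
  · exact hA.bernoulli a b h
  · have h1 := hA.bernoulli b a h
    rw [hf _ (grid_mem_Icc b) _ (grid_mem_Icc a)] at h1
    simp_rw [(hA.symm _).apply a b] at h1
    exact h1

lemma aemeasurable (hA : IsAdjacency P N ε f A) (a b : Fin N) :
    AEMeasurable (fun ω => A ω a b) P := by
  rcases le_total a b with h | h
  · exact (hA.bernoulli a b h).aemeasurable
  · have h1 := (hA.bernoulli b a h).aemeasurable
    simp_rw [(hA.symm _).apply a b] at h1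
    exact h1

lemma ae_eq_or (hA : IsAdjacency P N ε f A) : ∀ᵐ ω ∂P, ∀ a b, A ω a b = 1 ∨ A ω a b = 0 := by
  rw [ae_all_iff]
  intro a
  rw [ae_all_iff]
  intro b
  rcases le_total a b with h | h
  · exact (hA.bernoulli a b h).ae_eq_or
  · have h1 := (hA.bernoulli b a h).ae_eq_or
    simp_rw [(hA.symm _).apply a b] at h1
    exact h1

/-- Every function of the adjacency matrix is integrable: the matrix has finitely many values. -/
lemma integrable_comp [IsProbabilityMeasure P] (hA : IsAdjacency P N ε f A)
    (F : Matrix (Fin N) (Fin N) ℝ → ℝ) : Integrable (fun ω => F (A ω)) P := by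
  classical
  let G : (Fin N → Fin N → Bool) → Matrix (Fin N) (Fin N) ℝ :=
    fun B => Matrix.of fun a b => if B a b then 1 else 0
  let D : Ω → Fin N → Fin N → Bool := fun ω a b => decide (A ω a b = 1)
  have hD : AEMeasurable D P := by
    refine aemeasurable_pi_lambda _ fun a => aemeasurable_pi_lambda _ fun b => ?_
    have h1 : Measurable fun x : ℝ => decide (x = 1) := by
      refine measurable_to_bool ?_
      have : (fun x : ℝ => decide (x = 1)) ⁻¹' {true} = {1} := by
        ext x
        simp
      rw [this]
      exact measurableSet_singleton 1
    exact h1.comp_aemeasurable (hA.aemeasurable a b)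
  have hAD : (fun ω => F (A ω)) =ᵐ[P] fun ω => F (G (D ω)) := by
    filter_upwards [hA.ae_eq_or] with ω hω
    congr 1
    ext a b
    rcases hω a b with h | h <;> simp [G, D, h]
  -- The Boolean encoding has a finite discrete domain, so no regularity of `F` is required.
  have hm : Measurable fun B => F (G B) := Measurable.of_discrete
  refine Integrable.congr ?_ hAD.symm
  refine Integrable.of_bound (hm.comp_aemeasurable hD).aestronglyMeasurable
    (∑ B, |F (G B)|) (Eventually.of_forall fun ω => ?_)
  exact Finset.single_le_sum (f := fun B => |F (G B)|) (fun _ _ => abs_nonneg _)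
    (Finset.mem_univ (D ω))

/-- The centred entries, indexed by unordered pairs. -/
noncomputable def centredEntry (ε : ℝ) (f : ℝ → ℝ → ℝ) (A : Ω → Matrix (Fin N) (Fin N) ℝ) (e : Sym2 (Fin N))
    (ω : Ω) : ℝ :=
  A ω e.inf e.sup - edgeProb N ε f e.inf e.sup

/-- An unordered pair corresponds to its sorted pair (inf, sup), which transports independence. The
variance is p(1 - p) ≤ p ≤ ε M. -/
lemma isCentredFamily [IsProbabilityMeasure P] (hA : IsAdjacency P N ε f A) {M : ℝ} (hε : 0 ≤ ε)
    (hM : ∀ x ∈ Set.Icc (0 : ℝ) 1, ∀ y ∈ Set.Icc (0 : ℝ) 1, f x y ≤ M) :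
    IsCentredFamily P (ε * M) (centredEntry ε f A) where
  indep := by
    have h1 := (hA.indep.precomp Sym2.sortEquiv.injective).comp
      (fun e x => x - edgeProb N ε f e.inf e.sup) fun e => measurable_id.sub_const _
    exact h1
  aemeasurable e := (hA.aemeasurable _ _).sub_const _
  abs_le_one e := by
    have h1 := (hA.bernoulli e.inf e.sup e.inf_le_sup).mem_Icc
    filter_upwards [hA.ae_eq_or] with ω hω
    rw [centredEntry, abs_le]
    have h2 : edgeProb N ε f e.inf e.sup ∈ Set.Icc (0 : ℝ) 1 := h1
    rcases hω e.inf e.sup with h | h <;> rw [h] <;> constructor <;> linarith [h2.1, h2.2]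
  mean e := by
    have h1 := (hA.bernoulli e.inf e.sup e.inf_le_sup).integral_comp
      (g := fun x => x - edgeProb N ε f e.inf e.sup) (measurable_id.sub_const _)
    refine h1.trans ?_
    rw [edgeProb]
    ring
  var e := by
    have hB := hA.bernoulli e.inf e.sup e.inf_le_sup
    have h1 := hB.integral_comp
      (g := fun x => (x - edgeProb N ε f e.inf e.sup) ^ 2) ((measurable_id.sub_const _).pow_const 2)
    refine h1.le.trans ?_
    have h2 : edgeProb N ε f e.inf e.sup ∈ Set.Icc (0 : ℝ) 1 := hB.mem_Icc
    change edgeProb N ε f e.inf e.sup * (1 - edgeProb N ε f e.inf e.sup) ^ 2 +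
      (1 - edgeProb N ε f e.inf e.sup) * (0 - edgeProb N ε f e.inf e.sup) ^ 2 ≤ ε * M
    have h3 : edgeProb N ε f e.inf e.sup ≤ ε * M :=
      mul_le_mul_of_nonneg_left (hM _ (grid_mem_Icc _) _ (grid_mem_Icc _)) hε
    nlinarith [h2.1, h2.2]

lemma centred_eq (hA : IsAdjacency P N ε f A)
    (hf : ∀ x ∈ Set.Icc (0 : ℝ) 1, ∀ y ∈ Set.Icc (0 : ℝ) 1, f x y = f y x) (ω : Ω) :
    centred P A ω = A ω - Matrix.of (edgeProb N ε f) := by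
  rw [centred]
  congr 1
  ext a b
  exact (hA.isBernoulli hf a b).integral_eq

lemma centred_eq_symMatrix (hA : IsAdjacency P N ε f A)
    (hf : ∀ x ∈ Set.Icc (0 : ℝ) 1, ∀ y ∈ Set.Icc (0 : ℝ) 1, f x y = f y x) (ω : Ω) :
    centred P A ω = symMatrix (centredEntry ε f A) ω := by
  rw [hA.centred_eq hf]
  ext a b
  rw [Matrix.sub_apply, Matrix.of_apply, symMatrix_apply, centredEntry, Sym2.inf_mk, Sym2.sup_mk]
  rcases le_total a b with h | h
  · rw [inf_eq_left.2 h, sup_eq_right.2 h]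
  · rw [inf_eq_right.2 h, sup_eq_left.2 h, (hA.symm ω).apply]
    congr 1
    rw [edgeProb, edgeProb, hf _ (grid_mem_Icc a) _ (grid_mem_Icc b)]

end IsAdjacency

end Model

/-! ### Riemann sums of Lipschitz functions -/

section Riemann

/-- Each of the N cells has length 1/N, and on it g differs from its value at the right endpoint by
at most L/N. -/
lemma abs_riemann_sum_sub_integral_le {g : ℝ → ℝ} {L : ℝ}
    (hg : ∀ x ∈ Set.Icc (0 : ℝ) 1, ∀ y ∈ Set.Icc (0 : ℝ) 1, |g x - g y| ≤ L * |x - y|) {N : ℕ}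
    (hN : 0 < N) :
    |∑ a : Fin N, (N : ℝ)⁻¹ * g (((a : ℝ) + 1) / N) - ∫ x in Set.Icc (0 : ℝ) 1, g x| ≤
      L * (N : ℝ)⁻¹ := by
  have hN0 : (0 : ℝ) < N := Nat.cast_pos.2 hN
  have hL : 0 ≤ L := by
    have := (abs_nonneg _).trans (hg 0 (by simp) 1 (by simp))
    simpa using this
  have hcont : ContinuousOn g (Set.Icc 0 1) := by
    have : LipschitzOnWith (Real.toNNReal L) g (Set.Icc 0 1) := by
      refine LipschitzOnWith.of_dist_le_mul fun x hx y hy => ?_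
      rw [Real.dist_eq, Real.dist_eq, Real.coe_toNNReal _ hL]
      exact hg x hx y hy
    exact this.continuousOn
  have hsub : ∀ a : ℕ, a < N → Set.Icc ((a : ℝ) / N) ((a + 1 : ℕ) / N) ⊆ Set.Icc 0 1 := by
    intro a ha x hx
    have h1 : ((a + 1 : ℕ) : ℝ) / N ≤ 1 := div_le_one_of_le₀ (by exact_mod_cast ha) hN0.le
    exact ⟨le_trans (by positivity) hx.1, hx.2.trans h1⟩
  have hle : ∀ a : ℕ, (a : ℝ) / N ≤ (a + 1 : ℕ) / N := fun a => by
    gcongr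
    simp
  have hint : ∀ a : ℕ, a < N → IntervalIntegrable g volume ((a : ℝ) / N) ((a + 1 : ℕ) / N) := by
    intro a ha
    refine ContinuousOn.intervalIntegrable ?_
    rw [Set.uIcc_of_le (hle a)]
    exact hcont.mono (hsub a ha)
  have h1 : ∫ x in Set.Icc (0 : ℝ) 1, g x =
      ∑ a ∈ Finset.range N, ∫ x in ((a : ℝ) / N)..((a + 1 : ℕ) / N), g x := by
    rw [intervalIntegral.sum_integral_adjacent_intervals (a := fun a : ℕ => (a : ℝ) / N)
      (fun a ha => hint a ha), integral_Icc_eq_integral_Ioc,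
      ← intervalIntegral.integral_of_le zero_le_one]
    simp [hN0.ne']
  rw [h1, Finset.sum_range, ← Finset.sum_sub_distrib]
  refine (Finset.abs_sum_le_sum_abs _ _).trans ?_
  calc _ ≤ ∑ a : Fin N, L * (N : ℝ)⁻¹ * (N : ℝ)⁻¹ := by
        refine Finset.sum_le_sum fun a _ => ?_
        have h2 : (N : ℝ)⁻¹ * g (((a : ℝ) + 1) / N) =
            ∫ x in ((a : ℝ) / N)..((a + 1 : ℕ) / N), g (((a : ℝ) + 1) / N) := by
          rw [intervalIntegral.integral_const, smul_eq_mul]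
          congr 1
          push_cast
          field_simp
          ring
        rw [h2, ← intervalIntegral.integral_sub intervalIntegrable_const (hint a a.2)]
        have h3 := intervalIntegral.norm_integral_le_of_norm_le_const (a := (a : ℝ) / N)
          (b := ((a : ℕ) + 1 : ℕ) / N) (C := L * (N : ℝ)⁻¹)
          (f := fun x => g (((a : ℝ) + 1) / N) - g x) (fun x hx => by
            rw [Set.uIoc_of_le (hle a)] at hx
            have hx' := Set.Ioc_subset_Icc_self hx
            refine (hg _ (grid_mem_Icc a) _ (hsub a a.2 hx')).trans ?_
            gcongr
            rw [abs_le]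
            have e1 : ((a : ℕ) + 1 : ℕ) / (N : ℝ) = (a : ℝ) / N + (N : ℝ)⁻¹ := by
              push_cast
              field_simp
            have e2 : ((a : ℝ) + 1) / N = (a : ℝ) / N + (N : ℝ)⁻¹ := by field_simp
            rw [e1] at hx'
            rw [e2]
            constructor <;> linarith [hx'.1, hx'.2, inv_pos.2 hN0])
        refine h3.trans (le_of_eq ?_)
        congr 1
        push_cast
        rw [abs_of_nonneg] <;> field_simp <;> simp
    _ = _ := by
        simp only [Finset.sum_const, Finset.card_univ, Fintype.card_fin, nsmul_eq_mul]
        field_simp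

end Riemann

/-! ### Discretised eigenfunctions: boundedness, approximate orthonormality, and the mean matrix. -/

section Discretisation

open Matrix

variable {k : ℕ} {f : ℝ → ℝ → ℝ} {θ : Fin k → ℝ} {r : Fin k → ℝ → ℝ}

lemma IsSpectralDecomposition.symm (hf : IsSpectralDecomposition f θ r) :
    ∀ x ∈ Set.Icc (0 : ℝ) 1, ∀ y ∈ Set.Icc (0 : ℝ) 1, f x y = f y x := by
  intro x hx y hy
  rw [hf.decomp x hx y hy, hf.decomp y hy x hx]
  exact Finset.sum_congr rfl fun i _ => by ring

/-- Uniform bounds for the eigenfunctions and their Lipschitz constants. -/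
lemma AssumptionF2.exists_bounds (hF2 : AssumptionF2 r) :
    ∃ K L : ℝ, 1 ≤ K ∧ 0 ≤ L ∧ (∀ j, ∀ x ∈ Set.Icc (0 : ℝ) 1, |r j x| ≤ K) ∧
      ∀ j, ∀ x ∈ Set.Icc (0 : ℝ) 1, ∀ y ∈ Set.Icc (0 : ℝ) 1, |r j x - r j y| ≤ L * |x - y| := by
  choose L hL using hF2
  have hLip : ∀ j, ∀ x ∈ Set.Icc (0 : ℝ) 1, ∀ y ∈ Set.Icc (0 : ℝ) 1,
      |r j x - r j y| ≤ (∑ j, |L j|) * |x - y| := by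
    intro j x hx y hy
    refine (hL j x hx y hy).trans ?_
    gcongr
    exact (le_abs_self _).trans
      (Finset.single_le_sum (f := fun j => |L j|) (fun _ _ => abs_nonneg _) (Finset.mem_univ j))
  have hL0 : 0 ≤ ∑ j, |L j| := Finset.sum_nonneg fun _ _ => abs_nonneg _
  have hr0 : 0 ≤ ∑ j, |r j 0| := Finset.sum_nonneg fun _ _ => abs_nonneg _
  refine ⟨1 + (∑ j, |L j|) + ∑ j, |r j 0|, ∑ j, |L j|, by linarith, hL0, fun j x hx => ?_, hLip⟩
  have h1 := hLip j x hx 0 (by simp)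
  have h2 : |r j 0| ≤ ∑ j, |r j 0| :=
    Finset.single_le_sum (f := fun j => |r j 0|) (fun _ _ => abs_nonneg _) (Finset.mem_univ j)
  have h3 : |x - 0| ≤ 1 := by
    rw [sub_zero, abs_of_nonneg hx.1]
    exact hx.2
  have h4 := abs_sub_abs_le_abs_sub (r j x) (r j 0)
  nlinarith

/-- The bound is taken at least 1 so that N ε ≥ 1 implies N ε M ≥ 1, as the moment estimates with δ
= ε M demand. -/
lemma IsSpectralDecomposition.exists_le (hf : IsSpectralDecomposition f θ r) {K : ℝ}
    (hK : ∀ j, ∀ x ∈ Set.Icc (0 : ℝ) 1, |r j x| ≤ K) :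
    ∃ M : ℝ, 1 ≤ M ∧ ∀ x ∈ Set.Icc (0 : ℝ) 1, ∀ y ∈ Set.Icc (0 : ℝ) 1, f x y ≤ M := by
  refine ⟨1 + ∑ j, θ j * K ^ 2, ?_, fun x hx y hy => ?_⟩
  · have : 0 ≤ ∑ j, θ j * K ^ 2 :=
      Finset.sum_nonneg fun j _ => mul_nonneg (hf.pos j).le (sq_nonneg _)
    linarith
  · rw [hf.decomp x hx y hy]
    have : ∑ i, θ i * r i x * r i y ≤ ∑ j, θ j * K ^ 2 := by
      refine Finset.sum_le_sum fun j _ => ?_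
      rw [mul_assoc]
      refine mul_le_mul_of_nonneg_left ?_ (hf.pos j).le
      refine (le_abs_self _).trans ?_
      rw [abs_mul, sq]
      exact mul_le_mul (hK j x hx) (hK j y hy) (abs_nonneg _) ((abs_nonneg _).trans (hK j x hx))
    linarith

lemma abs_discretize_le {K : ℝ} (hK : ∀ j, ∀ x ∈ Set.Icc (0 : ℝ) 1, |r j x| ≤ K) (N : ℕ)
    (j : Fin k) (a : Fin N) : |discretize N (r j) a| ≤ (√N)⁻¹ * K := by
  rw [discretize, abs_mul, abs_of_nonneg (by positivity : 0 ≤ (√(N : ℝ))⁻¹)]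
  gcongr
  exact hK j _ (grid_mem_Icc a)

lemma inv_sqrt_mul_self (N : ℕ) : (√(N : ℝ))⁻¹ * (√(N : ℝ))⁻¹ = (N : ℝ)⁻¹ := by
  rw [← mul_inv, Real.mul_self_sqrt (Nat.cast_nonneg N)]

/-- The inner products are Riemann sums of r_j r_l, a function with Lipschitz constant 2KL. -/
lemma isAlmostOrthonormal_discretize (hf : IsSpectralDecomposition f θ r) {K L : ℝ}
    (hK : ∀ j, ∀ x ∈ Set.Icc (0 : ℝ) 1, |r j x| ≤ K)
    (hL : ∀ j, ∀ x ∈ Set.Icc (0 : ℝ) 1, ∀ y ∈ Set.Icc (0 : ℝ) 1, |r j x - r j y| ≤ L * |x - y|)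
    {N : ℕ} (hN : 0 < N) :
    IsAlmostOrthonormal (2 * K * L * (N : ℝ)⁻¹) fun j => discretize N (r j) := by
  intro j l
  have h1 := abs_riemann_sum_sub_integral_le (g := fun x => r j x * r l x) (L := 2 * K * L)
    (fun x hx y hy => by
      have h2 : r j x * r l x - r j y * r l y =
          r j x * (r l x - r l y) + (r j x - r j y) * r l y := by ring
      have hK0 : 0 ≤ K := (abs_nonneg _).trans (hK j x hx)
      rw [h2]
      calc _ ≤ |r j x * (r l x - r l y)| + |(r j x - r j y) * r l y| := abs_add_le _ _
        _ ≤ K * (L * |x - y|) + (L * |x - y|) * K := by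
          rw [abs_mul, abs_mul]
          have e1 := hK j x hx
          have e2 := hK l y hy
          have e3 := hL j x hx y hy
          have e4 := hL l x hx y hy
          exact add_le_add (mul_le_mul e1 e4 (abs_nonneg _) hK0)
            (mul_le_mul e3 e2 (abs_nonneg _) ((abs_nonneg _).trans e3))
        _ = _ := by ring) hN
  rw [hf.orthonormal] at h1
  have h3 : discretize N (r j) ⬝ᵥ discretize N (r l) =
      ∑ a : Fin N, (N : ℝ)⁻¹ * (r j (((a : ℝ) + 1) / N) * r l (((a : ℝ) + 1) / N)) := by
    rw [dotProduct]
    refine Finset.sum_congr rfl fun a _ => ?_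
    rw [discretize, discretize, ← inv_sqrt_mul_self]
    ring
  rw [h3]
  exact h1

/-- The factor N cancels the two factors N^{-1/2}, so the mean matrix is an exact spectral sum,
without discretisation error. -/
lemma edgeProb_eq (hf : IsSpectralDecomposition f θ r) {N : ℕ} (hN : 0 < N) (ε : ℝ)
    (a b : Fin N) : edgeProb N ε f a b =
      (N * ε) * ∑ j, θ j * (discretize N (r j) a * discretize N (r j) b) := by
  have hN0 : (N : ℝ) ≠ 0 := Nat.cast_ne_zero.2 hN.ne'
  rw [edgeProb, hf.decomp _ (grid_mem_Icc a) _ (grid_mem_Icc b), Finset.mul_sum, Finset.mul_sum]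
  refine Finset.sum_congr rfl fun j _ => ?_
  rw [discretize, discretize]
  have h := inv_sqrt_mul_self N
  calc _ = (N * (N : ℝ)⁻¹) * (ε * (θ j * r j (((a : ℝ) + 1) / N) * r j (((b : ℝ) + 1) / N))) := by
        rw [mul_inv_cancel₀ hN0, one_mul]
    _ = _ := by
        rw [← h]
        ring

lemma edgeProb_mulVec (hf : IsSpectralDecomposition f θ r) {N : ℕ} (hN : 0 < N) (ε : ℝ)
    (x : Fin N → ℝ) : Matrix.of (edgeProb N ε f) *ᵥ x =
      (N * ε) • ∑ j, (θ j * (discretize N (r j) ⬝ᵥ x)) • discretize N (r j) := by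
  ext a
  rw [Pi.smul_apply, Finset.sum_apply, smul_eq_mul]
  simp only [mulVec, dotProduct, Matrix.of_apply, edgeProb_eq hf hN, Pi.smul_apply, smul_eq_mul,
    Finset.mul_sum, Finset.sum_mul]
  rw [Finset.sum_comm]
  refine Finset.sum_congr rfl fun j _ => Finset.sum_congr rfl fun b _ => ?_
  ring

end Discretisation

/-! ### Expected size of the stochastic error terms. -/

section EntryError

open Matrix

lemma dotProduct_pow_four_eq {N : ℕ} {W : Matrix (Fin N) (Fin N) ℝ} (hW : W.IsSymm)
    (x : Fin N → ℝ) : x ⬝ᵥ (W ^ 4) *ᵥ x = (W ^ 2) *ᵥ x ⬝ᵥ (W ^ 2) *ᵥ x := by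
  have hW2 : (W ^ 2).IsSymm := by rw [Matrix.IsSymm, Matrix.transpose_pow, hW.eq]
  rw [← dotProduct_mulVec_comm_of_isSymm hW2, mulVec_mulVec, ← pow_add]

lemma entryError_nonneg {N k : ℕ} {s : ℝ} (hs : 0 ≤ s) (e : Fin k → Fin N → ℝ)
    (T : Fin k → Fin k → ℝ) {W : Matrix (Fin N) (Fin N) ℝ} (hW : W.IsSymm) (j l : Fin k) :
    0 ≤ entryError s e T W j l := by
  have h : ∀ x, 0 ≤ x ⬝ᵥ (W ^ 4) *ᵥ x := fun x => by
    rw [dotProduct_pow_four_eq hW]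
    exact dotProduct_self_nonneg' _
  have := h (e j)
  have := h (e l)
  rw [entryError]
  positivity

/-- The numerical constant in the fluctuation bounds. -/
noncomputable def fluctConst (K M : ℝ) (n : ℕ) : ℝ :=
  √(K ^ 4 * (2 * (n + 1) ^ 2 * (2 * n + 2) ^ n * (n + 2) ^ n) * M ^ n)

variable {N k : ℕ} {Ω : Type*} [MeasurableSpace Ω] {P : Measure Ω} [IsProbabilityMeasure P]
  {X : Sym2 (Fin N) → Ω → ℝ} {K M ε : ℝ}

/-- The variance is of order (Nε)^{n+1}/N = (Nε)^n ε, which is at most (Nε)^{2n} ε because Nε ≥ 1.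
The square root is taken. -/
lemma IsCentredFamily.integral_abs_sub_le (hX : IsCentredFamily P (ε * M) X) (hN : 0 < N)
    (hK : 1 ≤ K) (hM : 1 ≤ M) (hs : 1 ≤ N * ε) {u v : Fin N → ℝ} (hu : ∀ a, |u a| ≤ (√N)⁻¹ * K)
    (hv : ∀ a, |v a| ≤ (√N)⁻¹ * K) (n : ℕ)
    (hint : Integrable (fun ω => (u ⬝ᵥ (symMatrix X ω ^ (n + 1)) *ᵥ v -
        ∫ ω', u ⬝ᵥ (symMatrix X ω' ^ (n + 1)) *ᵥ v ∂P) ^ 2) P) :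
    ∫ ω, |u ⬝ᵥ (symMatrix X ω ^ (n + 1)) *ᵥ v -
        ∫ ω', u ⬝ᵥ (symMatrix X ω' ^ (n + 1)) *ᵥ v ∂P| ∂P ≤
      (N * ε) ^ n * (fluctConst K M (n + 1) * √ε) := by
  have hN0 : (0 : ℝ) < N := Nat.cast_pos.2 hN
  have hε : 0 < ε := by
    by_contra! h
    nlinarith
  have hNδ : 1 ≤ N * (ε * M) := by nlinarith
  have hfc : 0 < fluctConst K M (n + 1) := Real.sqrt_pos.2 (by positivity)
  refine integral_abs_le_of_integral_sq_le
    ((hX.integrable_dotProduct_pow u v (n + 1)).sub (integrable_const _)) hint (by positivity) ?_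
  refine (hX.variance_dotProduct_pow_le_of_delocalised (by positivity) hN hNδ hu hv (by linarith)
    (n + 1)).trans ?_
  rw [mul_pow ((N * ε) ^ n), mul_pow (fluctConst K M (n + 1)), Real.sq_sqrt hε.le, fluctConst, Real.sq_sqrt (by positivity)]
  set Q : ℝ := K ^ 4 * (2 * ((n + 1 : ℕ) + 1 : ℝ) ^ 2 * (2 * (n + 1 : ℕ) + 2 : ℝ) ^ (n + 1) *
    ((n + 1 : ℕ) + 2 : ℝ) ^ (n + 1)) with hQ
  have hQ0 : 0 ≤ Q := by positivity
  calc Q * ((N * (ε * M)) ^ (n + 1) * (N : ℝ)⁻¹) = (N * ε) ^ n * 1 * (Q * M ^ (n + 1) * ε) := by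
        rw [← mul_assoc (N : ℝ) ε M, mul_pow (N * ε) M, pow_succ (N * ε) n]
        field_simp
    _ ≤ (N * ε) ^ n * (N * ε) ^ n * (Q * M ^ (n + 1) * ε) := by
        gcongr
        exact one_le_pow₀ hs
    _ = _ := by ring

/-- The expected stochastic error. -/
lemma IsCentredFamily.integral_entryError_le (hX : IsCentredFamily P (ε * M) X) (hN : 0 < N)
    (hK : 1 ≤ K) (hM : 1 ≤ M) (hs : 1 ≤ N * ε) {e : Fin k → Fin N → ℝ}
    (he : ∀ j a, |e j a| ≤ (√N)⁻¹ * K) (j l : Fin k)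
    (hint : ∀ n, Integrable (fun ω => (e j ⬝ᵥ (symMatrix X ω ^ (n + 1)) *ᵥ e l -
        ∫ ω', e j ⬝ᵥ (symMatrix X ω' ^ (n + 1)) *ᵥ e l ∂P) ^ 2) P) :
    ∫ ω, entryError (N * ε) e (fun j l => ∫ ω', e j ⬝ᵥ (symMatrix X ω' ^ 2) *ᵥ e l ∂P)
        (symMatrix X ω) j l ∂P ≤
      (fluctConst K M 1 + fluctConst K M 2 + fluctConst K M 3 + K ^ 2 * (5 ^ 3 * M) +
        2 * (K ^ 2 * (6 ^ 4 * M ^ 2))) * (√ε + (N * ε)⁻¹) := by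
  set s : ℝ := N * ε with hsdef
  have hN0 : (0 : ℝ) < N := Nat.cast_pos.2 hN
  have hs0 : 0 < s := by linarith
  have hε : 0 < ε := by
    by_contra! h
    nlinarith
  have hNδ' : N * (ε * M) = s * M := by rw [hsdef]; ring
  have hNδ : 1 ≤ N * (ε * M) := by nlinarith
  have hK0 : 0 ≤ K := by linarith
  have hδ : 0 < ε * M := by positivity
  have hI := fun (u v : Fin N → ℝ) n => hX.integrable_dotProduct_pow u v n
  -- After weighting by powers of s⁻¹, each fluctuation is O(√ε). The linear term has mean zero,
  -- while the means of the cubic and quartic terms, of order s and s², contribute O(1/s).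
  have b1 := hX.integral_abs_sub_le hN hK hM hs (he j) (he l) 0 (hint 0)
  have b2 := hX.integral_abs_sub_le hN hK hM hs (he j) (he l) 1 (hint 1)
  have b3 := hX.integral_abs_sub_le hN hK hM hs (he j) (he l) 2 (hint 2)
  have c3 := hX.abs_integral_dotProduct_pow_le_of_delocalised hδ hN hNδ (he j) (he l) hK0 3
  have c4 := fun j => (le_abs_self _).trans
    (hX.abs_integral_dotProduct_pow_le_of_delocalised hδ hN hNδ (he j) (he j) hK0 4)
  rw [hNδ'] at c3 c4
  norm_num at b1 b2 b3 c3 c4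
  have hone := hX.integral_dotProduct_pow_one (e j) (e l)
  simp only [pow_one] at hone
  rw [hone] at b1
  simp only [sub_zero] at b1
  rw [← hsdef] at b2 b3
  set E3 := ∫ ω, e j ⬝ᵥ (symMatrix X ω ^ 3) *ᵥ e l ∂P with hE3
  set E2 := ∫ ω, e j ⬝ᵥ (symMatrix X ω ^ 2) *ᵥ e l ∂P with hE2
  have i1 : Integrable (fun ω => |e j ⬝ᵥ symMatrix X ω *ᵥ e l|) P := by
    simpa using (hI (e j) (e l) 1).abs
  have i2 : Integrable (fun ω => |e j ⬝ᵥ (symMatrix X ω ^ 2) *ᵥ e l - E2|) P :=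
    ((hI (e j) (e l) 2).sub (integrable_const _)).abs
  have i3 : Integrable (fun ω => |e j ⬝ᵥ (symMatrix X ω ^ 3) *ᵥ e l - E3|) P :=
    ((hI (e j) (e l) 3).sub (integrable_const _)).abs
  have i4 := fun j => hI (e j) (e j) 4
  have hpt : ∀ ω, entryError s e (fun j l => ∫ ω', e j ⬝ᵥ (symMatrix X ω' ^ 2) *ᵥ e l ∂P)
      (symMatrix X ω) j l ≤ |e j ⬝ᵥ symMatrix X ω *ᵥ e l| +
        s⁻¹ * |e j ⬝ᵥ (symMatrix X ω ^ 2) *ᵥ e l - E2| +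
        s⁻¹ ^ 2 * (|e j ⬝ᵥ (symMatrix X ω ^ 3) *ᵥ e l - E3| + |E3|) +
        s⁻¹ ^ 3 * (e j ⬝ᵥ (symMatrix X ω ^ 4) *ᵥ e j + e l ⬝ᵥ (symMatrix X ω ^ 4) *ᵥ e l) := by
    intro ω
    rw [entryError, pow_one]
    gcongr
    have := abs_add_le (e j ⬝ᵥ (symMatrix X ω ^ 3) *ᵥ e l - E3) E3
    rwa [sub_add_cancel] at this
  have j2 := i2.const_mul s⁻¹
  have j3 := (i3.add (integrable_const |E3|)).const_mul (s⁻¹ ^ 2)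
  have j4 := ((i4 j).add (i4 l)).const_mul (s⁻¹ ^ 3)
  have hmono := integral_mono_of_nonneg (μ := P)
    (Eventually.of_forall fun ω => entryError_nonneg hs0.le e
      (fun j l => ∫ ω', e j ⬝ᵥ (symMatrix X ω' ^ 2) *ᵥ e l ∂P) (symMatrix_isSymm X ω) j l)
    (((i1.add j2).add j3).add j4) (Eventually.of_forall hpt)
  refine hmono.trans ?_
  rw [integral_add' ((i1.add j2).add j3) j4, integral_add' (i1.add j2) j3, integral_add' i1 j2,
    integral_const_mul, integral_const_mul, integral_const_mul,
    integral_add' i3 (integrable_const _), integral_add' (i4 j) (i4 l), integral_const]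
  simp only [probReal_univ, one_smul]
  have hσ : s * s⁻¹ = 1 := mul_inv_cancel₀ hs0.ne'
  have hσ0 : 0 < s⁻¹ := inv_pos.2 hs0
  set σ := s⁻¹ with hσdef
  have f0 : ∀ n, 0 ≤ fluctConst K M n := fun n => Real.sqrt_nonneg _
  have q0 := Real.sqrt_nonneg ε
  have d2 : σ * ∫ ω, |e j ⬝ᵥ (symMatrix X ω ^ 2) *ᵥ e l - E2| ∂P ≤ fluctConst K M 2 * √ε := by
    calc _ ≤ σ * (s * (fluctConst K M 2 * √ε)) := by gcongr
      _ = (s * σ) * (fluctConst K M 2 * √ε) := by ring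
      _ = _ := by rw [hσ, one_mul]
  have d3 : σ ^ 2 * (∫ ω, |e j ⬝ᵥ (symMatrix X ω ^ 3) *ᵥ e l - E3| ∂P + |E3|) ≤
      fluctConst K M 3 * √ε + K ^ 2 * (5 ^ 3 * M) * σ := by
    calc _ ≤ σ ^ 2 * (s ^ 2 * (fluctConst K M 3 * √ε) + K ^ 2 * 125 * (s * M)) := by gcongr
      _ = (s * σ) ^ 2 * (fluctConst K M 3 * √ε) + (s * σ) * (K ^ 2 * 125 * M) * σ := by ring
      _ = _ := by
        rw [hσ]
        ring
  have d4 : σ ^ 3 * (∫ ω, e j ⬝ᵥ (symMatrix X ω ^ 4) *ᵥ e j ∂P +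
      ∫ ω, e l ⬝ᵥ (symMatrix X ω ^ 4) *ᵥ e l ∂P) ≤ 2 * (K ^ 2 * (6 ^ 4 * M ^ 2)) * σ := by
    calc _ ≤ σ ^ 3 * (K ^ 2 * 1296 * (s * M) ^ 2 + K ^ 2 * 1296 * (s * M) ^ 2) := by
          gcongr
          · exact c4 j
          · exact c4 l
      _ = (s * σ) ^ 2 * (2 * (K ^ 2 * 1296 * M ^ 2)) * σ := by ring
      _ = _ := by
        rw [hσ]
        ring
  have g1 := mul_nonneg (f0 1) hσ0.le
  have g2 := mul_nonneg (f0 2) hσ0.le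
  have g3 := mul_nonneg (f0 3) hσ0.le
  have g4 : 0 ≤ K ^ 2 * (5 ^ 3 * M) * √ε := by positivity
  have g5 : 0 ≤ 2 * (K ^ 2 * (6 ^ 4 * M ^ 2)) * √ε := by positivity
  linarith

end EntryError

/-! ### A priori bounds and the growth of the sparsity. -/

section Final

open Matrix

lemma abs_eig_le {n : ℕ} {M : Matrix (Fin n) (Fin n) ℝ} (hM : M.IsSymm) {i : ℕ} (hi : i < n) :
    |eig M i| ≤ ∑ j, ∑ l, |M j l| := by
  obtain ⟨x, hx0, hx⟩ := exists_eigenvector hM hi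
  have h1 := abs_quadForm_le M x
  have hpos := dotProduct_self_pos hx0
  rw [hx, dotProduct_smul, smul_eq_mul, abs_mul, abs_of_pos hpos] at h1
  exact le_of_mul_le_mul_right h1 hpos

namespace IsAdjacency

variable {Ω : Type*} [MeasurableSpace Ω] {P : Measure Ω} {N : ℕ} {ε : ℝ} {f : ℝ → ℝ → ℝ}
  {A : Ω → Matrix (Fin N) (Fin N) ℝ}

lemma integrable_comp_symMatrix [IsProbabilityMeasure P] (hA : IsAdjacency P N ε f A)
    (hf : ∀ x ∈ Set.Icc (0 : ℝ) 1, ∀ y ∈ Set.Icc (0 : ℝ) 1, f x y = f y x)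
    (F : Matrix (Fin N) (Fin N) ℝ → ℝ) :
    Integrable (fun ω => F (symMatrix (centredEntry ε f A) ω)) P := by
  simp_rw [← hA.centred_eq_symMatrix hf, hA.centred_eq hf]
  exact hA.integrable_comp fun Q => F (Q - Matrix.of (edgeProb N ε f))

lemma ae_abs_eig_le (hA : IsAdjacency P N ε f A) {i : ℕ} (hi : i < N) :
    ∀ᵐ ω ∂P, |eig (A ω) i| ≤ (N : ℝ) ^ 2 := by
  filter_upwards [hA.ae_eq_or] with ω hω
  refine (abs_eig_le (hA.symm ω) hi).trans ?_
  calc ∑ j, ∑ l, |A ω j l| ≤ ∑ j : Fin N, ∑ l : Fin N, (1 : ℝ) := by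
        refine Finset.sum_le_sum fun j _ => Finset.sum_le_sum fun l _ => ?_
        rcases hω j l with h | h <;> simp [h]
    _ = _ := by simp [sq]

lemma matB_isSymm {k : ℕ} (hA : IsAdjacency P N ε f A)
    (hf : ∀ x ∈ Set.Icc (0 : ℝ) 1, ∀ y ∈ Set.Icc (0 : ℝ) 1, f x y = f y x) (θ : Fin k → ℝ)
    (r : Fin k → ℝ → ℝ) (i : Fin k) : (matB P ε θ r A i).IsSymm := by
  ext j l
  have h : ∀ ω, discretize N (r l) ⬝ᵥ (centred P A ω ^ 2) *ᵥ discretize N (r j) =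
      discretize N (r j) ⬝ᵥ (centred P A ω ^ 2) *ᵥ discretize N (r l) := fun ω => by
    have hW : (centred P A ω ^ 2).IsSymm := by
      rw [hA.centred_eq_symMatrix hf, Matrix.IsSymm, Matrix.transpose_pow,
        (symMatrix_isSymm _ ω).eq]
    rw [dotProduct_mulVec_comm_of_isSymm hW, dotProduct_comm]
  rw [Matrix.transpose_apply, matB, Matrix.of_apply, Matrix.of_apply, mul_comm (θ l),
    dotProduct_comm (discretize N (r l))]
  simp_rw [h]

end IsAdjacency

/-- Consequences of the growth condition on the sparsity. -/
lemma AssumptionE1.eventually_log_le {ε : ℕ → ℝ} (hE1 : AssumptionE1 ε)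
    (hε : ∀ N, 1 ≤ N → 0 < ε N) {τ : ℝ} (hτ : 0 < τ) :
    ∀ᶠ N : ℕ in atTop, 1 ≤ Real.log N ∧ Real.log N ≤ τ * (N * ε N) := by
  obtain ⟨⟨ξ, hξ, hlim⟩, -⟩ := hE1
  -- As e < 3, N ≥ 3 gives log N ≥ 1, so that log N ≤ (log N)^ξ.
  filter_upwards [hlim.eventually (eventually_le_nhds hτ), eventually_ge_atTop 3] with N h1 h3
  have hN : (0 : ℝ) < N := by positivity
  have hs : 0 < N * ε N := mul_pos hN (hε N (by omega))
  have hlog : 1 ≤ Real.log N := by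
    rw [Real.le_log_iff_exp_le hN]
    have : (3 : ℝ) ≤ N := by exact_mod_cast h3
    linarith [Real.exp_one_lt_d9]
  refine ⟨hlog, ?_⟩
  rw [one_div, inv_mul_le_iff₀ hs] at h1
  calc Real.log N = Real.log N ^ (1 : ℝ) := (Real.rpow_one _).symm
    _ ≤ Real.log N ^ ξ := Real.rpow_le_rpow_of_exponent_le hlog (by linarith)
    _ ≤ _ := h1.trans (le_of_eq (by ring))

end Final

end InhomER

/-! ### Assembly: deterministic expansion, expected errors, and the exceptional event. -/

set_option maxHeartbeats 1000000 in
theorem mainTheorem4 {k : ℕ} (f : ℝ → ℝ → ℝ) (θ : Fin k → ℝ) (r : Fin k → ℝ → ℝ)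
    (hf : InhomER.IsSpectralDecomposition f θ r) (hF2 : InhomER.AssumptionF2 r)
    (ε : ℕ → ℝ) (hε : InhomER.IsSparsitySeq f ε) (hE1 : InhomER.AssumptionE1 ε)
    {Ω : ℕ → Type*} [∀ N, MeasurableSpace (Ω N)] (P : ∀ N, Measure (Ω N))
    [∀ N, IsProbabilityMeasure (P N)]
    (A : ∀ N, Ω N → Matrix (Fin N) (Fin N) ℝ)
    (hA : ∀ N, 1 ≤ N → InhomER.IsAdjacency (P N) N (ε N) f (A N))
    (i : Fin k) (hi : i ∈ InhomER.isolated θ) :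
    (∀ N, 1 ≤ N → Integrable (fun ω => InhomER.eig (A N ω) i) (P N)) ∧
    (∀ N, 1 ≤ N → (InhomER.matB (P N) (ε N) θ r (A N) i).IsSymm) ∧
    (fun N : ℕ => (∫ ω, InhomER.eig (A N ω) i ∂(P N)) -
        InhomER.eig (InhomER.matB (P N) (ε N) θ r (A N) i) i)
      =O[atTop] fun N : ℕ => Real.sqrt (ε N) + ((N : ℝ) * ε N)⁻¹ := by
  open InhomER Matrix in
  refine ⟨fun N hN => (hA N hN).integrable_comp fun Q => eig Q i,
    fun N hN => (hA N hN).matB_isSymm hf.symm θ r i, ?_⟩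
  have hε0 : ∀ N, 1 ≤ N → 0 < ε N := fun N hN => (hε N hN).1
  obtain ⟨K, L, hK1, hL0, hK, hL⟩ := hF2.exists_bounds
  obtain ⟨M, hM1, hM⟩ := hf.exists_le hK
  obtain ⟨εl, hεl0, hεl⟩ := hE1.2
  have hK0 : 0 < K := by linarith
  have hM0 : 0 < M := by linarith
  obtain ⟨E, hE⟩ : ∃ E, E = εl + 1 := ⟨_, rfl⟩
  have hE0 : 0 < E := by linarith
  have hEev : ∀ᶠ N in atTop, ε N ≤ E := hεl.eventually (eventually_le_nhds (by linarith))
  -- The first summand bounds s η for η = 2KL/N; the second bounds E(e_j'W²e_l)/s.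
  obtain ⟨C₀, hC₀⟩ : ∃ C₀, C₀ = 2 * K * L * E + K ^ 2 * 4 ^ 2 * M := ⟨_, rfl⟩
  have hC₀0 : 0 ≤ C₀ := by rw [hC₀]; positivity
  obtain ⟨c, hc, C, hC, hdet⟩ := InhomER.exists_abs_eig_sub_eig_le hf.antitone hf.pos hi hC₀0
  obtain ⟨Θ, hΘ⟩ : ∃ Θ, ∀ j, θ j ≤ Θ :=
    ⟨∑ j, θ j, fun j => Finset.single_le_sum (fun l _ => (hf.pos l).le) (Finset.mem_univ j)⟩
  have hΘ0 : 0 < Θ := (hf.pos i).trans_le (hΘ i)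
  have hsqrt : ∀ j l, √(θ j * θ l) ≤ Θ := fun j l => by
    rw [Real.sqrt_le_left hΘ0.le, sq]
    exact mul_le_mul (hΘ j) (hΘ l) (hf.pos l).le hΘ0.le
  have hθi := hf.pos i
  obtain ⟨C₁, hC₁⟩ : ∃ C₁, C₁ = Θ * E * (1 + 2 * K * L) + (θ i ^ 2)⁻¹ * Θ * C₀ := ⟨_, rfl⟩
  have hC₁0 : 0 ≤ C₁ := by rw [hC₁]; positivity
  obtain ⟨D, hD⟩ : ∃ D, D = fluctConst K M 1 + fluctConst K M 2 + fluctConst K M 3 +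
      K ^ 2 * (5 ^ 3 * M) + 2 * (K ^ 2 * (6 ^ 4 * M ^ 2)) := ⟨_, rfl⟩
  -- With 2m + 1 ≤ 5 log N, the first entry gives 2m + 1 ≤ s and the second 4(2m + 1) s M ≤ e⁻⁴ (c
  -- s)²: the two requirements of the trace bound.
  have hτ : 0 < min (1 / 5) (Real.exp (-4) * c ^ 2 / (20 * M)) := by positivity
  have hηev : ∀ᶠ N : ℕ in atTop, 2 * K * L * (N : ℝ)⁻¹ ≤ c := by
    have : Tendsto (fun N : ℕ => 2 * K * L * (N : ℝ)⁻¹) atTop (𝓝 (2 * K * L * 0)) :=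
      tendsto_inv_atTop_nhds_zero_nat.const_mul _
    rw [mul_zero] at this
    exact this.eventually (eventually_le_nhds hc)
  refine IsBigO.of_bound (C * (1 + k ^ 2 * D) + (1 + k ^ 2 * C₁) * E) ?_
  filter_upwards [hE1.eventually_log_le hε0 hτ, hEev, hηev, eventually_ge_atTop (k + 1)] with
    N ⟨hlog1, hlogs⟩ hεE hηc hNk
  have hN : 0 < N := by omega
  have hN0 : (0 : ℝ) < N := Nat.cast_pos.2 hN
  have hN1 : (1 : ℝ) ≤ N := by exact_mod_cast hN
  have hiN : (i : ℕ) < N := by omega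
  have hAN := hA N hN
  have hεN := hε0 N hN
  obtain ⟨s, hs⟩ : ∃ s : ℝ, s = N * ε N := ⟨_, rfl⟩
  have hs0 : 0 < s := by rw [hs]; positivity
  rw [← hs] at hlogs
  have hlog5 : 5 * Real.log N ≤ s := by
    have := hlogs.trans (mul_le_mul_of_nonneg_right (min_le_left _ _) hs0.le)
    linarith
  have hlogc : 20 * Real.log N * M ≤ Real.exp (-4) * c ^ 2 * s := by
    have := hlogs.trans (mul_le_mul_of_nonneg_right (min_le_right _ _) hs0.le)
    calc 20 * Real.log N * M ≤ 20 * (Real.exp (-4) * c ^ 2 / (20 * M) * s) * M := by gcongr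
      _ = _ := by field_simp
  have hs1 : 1 ≤ s := by linarith
  obtain ⟨m, hm⟩ : ∃ m : ℕ, m = ⌈Real.log N⌉₊ := ⟨_, rfl⟩
  have hm1 : Real.log N ≤ m := hm ▸ Nat.le_ceil _
  have hm2 : (m : ℝ) < Real.log N + 1 := hm ▸ Nat.ceil_lt_add_one (by linarith)
  have hm0 : m ≠ 0 := by
    rintro rfl
    norm_num at hm1
    linarith
  have hm5 : (2 * m + 1 : ℝ) ≤ 5 * Real.log N := by linarith
  have hX := hAN.isCentredFamily hεN.le hM
  have hWX := hAN.centred_eq_symMatrix hf.symm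
  have hint := fun F => hAN.integrable_comp_symMatrix hf.symm F
  set X := IsAdjacency.centredEntry (ε N) f (A N) with hXdef
  set e : Fin k → Fin N → ℝ := fun j => discretize N (r j) with he
  have hedel : ∀ j a, |e j a| ≤ (√N)⁻¹ * K := abs_discretize_le hK N
  have heo : IsAlmostOrthonormal (2 * K * L * (N : ℝ)⁻¹) e :=
    isAlmostOrthonormal_discretize hf hK hL hN
  set T : Fin k → Fin k → ℝ := fun j l =>
    ∫ ω, e j ⬝ᵥ (symMatrix X ω ^ 2) *ᵥ e l ∂(P N) with hT
  have hNδ : N * (ε N * M) = s * M := by rw [hs]; ring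
  have hTb : ∀ j l, |T j l| ≤ C₀ * s := fun j l => by
    have h1 := hX.abs_integral_dotProduct_pow_le_of_delocalised (by positivity) hN
      (by rw [hNδ]; nlinarith) (hedel j) (hedel l) hK0.le 2
    refine h1.trans ?_
    rw [hNδ, hC₀]
    norm_num
    have : 0 ≤ 2 * K * L * E * s := by positivity
    linarith
  have hTs : ∀ j l, T j l = T l j := fun j l => by
    refine integral_congr_ae (Eventually.of_forall fun ω => ?_)
    have hW2 : (symMatrix X ω ^ 2).IsSymm := by
      rw [Matrix.IsSymm, Matrix.transpose_pow, (symMatrix_isSymm X ω).eq]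
    change e j ⬝ᵥ _ = e l ⬝ᵥ _
    rw [dotProduct_mulVec_comm_of_isSymm hW2, dotProduct_comm]
  have hB : matB (P N) (ε N) θ r (A N) i = Matrix.of fun j l => √(θ j * θ l) * s * (e j ⬝ᵥ e l) +
      (θ i ^ 2)⁻¹ * √(θ j * θ l) * s⁻¹ * T j l := by
    rw [matB, hs]
    simp_rw [hWX]
    rfl
  have hBs := hAN.matB_isSymm hf.symm θ r i
  rw [hB] at hBs ⊢
  set B : Matrix (Fin k) (Fin k) ℝ := Matrix.of fun j l => √(θ j * θ l) * s * (e j ⬝ᵥ e l) +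
      (θ i ^ 2)⁻¹ * √(θ j * θ l) * s⁻¹ * T j l with hBdef
  have hsN : s ≤ E * N := by
    rw [hs, mul_comm]
    gcongr
  have hBb : |eig B i| ≤ k ^ 2 * C₁ * N := by
    refine (abs_eig_le hBs i.2).trans ?_
    calc ∑ j, ∑ l, |B j l| ≤ ∑ j : Fin k, ∑ l : Fin k, C₁ * N := by
          refine Finset.sum_le_sum fun j _ => Finset.sum_le_sum fun l _ => ?_
          have h1 : |e j ⬝ᵥ e l| ≤ 1 + 2 * K * L := by
            have h2 := heo j l
            have h3 : 2 * K * L * (N : ℝ)⁻¹ ≤ 2 * K * L :=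
              mul_le_of_le_one_right (by positivity) (inv_le_one_of_one_le₀ hN1)
            have h4 := abs_sub_abs_le_abs_sub (e j ⬝ᵥ e l) (if j = l then 1 else 0)
            have h5 : |(if j = l then (1 : ℝ) else 0)| ≤ 1 := by split_ifs <;> simp
            linarith
          rw [hBdef, Matrix.of_apply]
          refine (abs_add_le _ _).trans ?_
          rw [abs_mul (√(θ j * θ l) * s) (e j ⬝ᵥ e l),
            abs_mul ((θ i ^ 2)⁻¹ * √(θ j * θ l) * s⁻¹) (T j l),
            abs_of_nonneg (show 0 ≤ √(θ j * θ l) * s by positivity),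
            abs_of_nonneg (show 0 ≤ (θ i ^ 2)⁻¹ * √(θ j * θ l) * s⁻¹ by positivity)]
          calc _ ≤ Θ * (E * N) * (1 + 2 * K * L) + (θ i ^ 2)⁻¹ * Θ * s⁻¹ * (C₀ * s) := by
                gcongr
                · exact hsqrt j l
                · exact hsqrt j l
                · exact hTb j l
            _ = Θ * E * (1 + 2 * K * L) * N + (θ i ^ 2)⁻¹ * Θ * C₀ * 1 := by field_simp
            _ ≤ Θ * E * (1 + 2 * K * L) * N + (θ i ^ 2)⁻¹ * Θ * C₀ * N := by gcongr
            _ = _ := by rw [hC₁]; ring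
      _ = _ := by simp; ring
  obtain ⟨b, hb⟩ : ∃ b, b = c * s := ⟨_, rfl⟩
  have hb0 : 0 < b := by rw [hb]; positivity
  set tr : Ω N → ℝ := fun ω => (symMatrix X ω ^ (2 * m)).trace with htr
  have htr0 : ∀ ω, 0 ≤ tr ω := fun ω => trace_pow_two_mul_nonneg (symMatrix_isSymm X ω) m
  have htrint : ∫ ω, tr ω ∂(P N) ≤ b ^ (2 * m) * (N : ℝ)⁻¹ ^ 3 := by
    refine hX.integral_trace_div_le (by positivity) hN ?_ hb0 ?_ hm1
    · rw [hNδ]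
      nlinarith
    · rw [hNδ]
      calc 4 * (2 * m + 1) * (s * M) ≤ 4 * (5 * Real.log N) * (s * M) := by gcongr
        _ = (20 * Real.log N * M) * s := by ring
        _ ≤ (Real.exp (-4) * c ^ 2 * s) * s := by gcongr
        _ = _ := by rw [hb]; ring
  have herr0 : ∀ ω, 0 ≤ ∑ j, ∑ l, entryError s e T (symMatrix X ω) j l := fun ω =>
    Finset.sum_nonneg fun j _ => Finset.sum_nonneg fun l _ =>
      entryError_nonneg hs0.le e T (symMatrix_isSymm X ω) j l
  -- If the trace is at most b^{2m}, the deterministic expansion applies. Otherwise the trace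
  -- quotient exceeds 1 and dominates the trivial bound, as in Markov's inequality.
  have hpt : ∀ᵐ ω ∂(P N), |eig (A N ω) i - eig B i| ≤
      C * (s⁻¹ + ∑ j, ∑ l, entryError s e T (symMatrix X ω) j l) +
        (1 + k ^ 2 * C₁) * N ^ 2 * ((b ^ (2 * m))⁻¹ * tr ω) := by
    filter_upwards [hAN.ae_abs_eig_le hiN] with ω hω
    have hsi : 0 ≤ s⁻¹ := (inv_pos.2 hs0).le
    have hbm : 0 < b ^ (2 * m) := by positivity
    by_cases htrb : tr ω ≤ b ^ (2 * m)
    · have h1 := hdet N e (symMatrix X ω) (A N ω) T s _ hiN hs1 (symMatrix_isSymm X ω)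
        (hAN.symm ω) (fun x => by
          rw [← hb]
          exact mulVec_dotProduct_self_le_of_trace_le (symMatrix_isSymm X ω) hm0 htrb x)
        (fun x => by
          have h2 := edgeProb_mulVec hf hN (ε N) x
          rw [← hs] at h2
          rw [← h2, ← hWX, hAN.centred_eq hf.symm, sub_mulVec, sub_add_cancel])
        heo hηc (by
          rw [hC₀, hs]
          calc N * ε N * (2 * K * L * (N : ℝ)⁻¹) = 2 * K * L * ε N := by field_simp
            _ ≤ 2 * K * L * E := by gcongr
            _ ≤ _ := by
              have : 0 ≤ K ^ 2 * 4 ^ 2 * M := by positivity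
              linarith) hTb hTs
      refine h1.trans (le_add_of_nonneg_right ?_)
      have := htr0 ω
      positivity
    · push Not at htrb
      have h1 : 1 ≤ (b ^ (2 * m))⁻¹ * tr ω := by
        rw [← div_eq_inv_mul, le_div_iff₀ hbm, one_mul]
        exact htrb.le
      have h2 : |eig (A N ω) i - eig B i| ≤ (1 + k ^ 2 * C₁) * N ^ 2 := by
        refine (abs_sub _ _).trans ?_
        have h3 : (k : ℝ) ^ 2 * C₁ * N ≤ k ^ 2 * C₁ * N ^ 2 := by
          gcongr
          nlinarith
        linarith
      have h4 : 0 ≤ C * (s⁻¹ + ∑ j, ∑ l, entryError s e T (symMatrix X ω) j l) :=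
        mul_nonneg hC (add_nonneg hsi (herr0 ω))
      have h5 : (1 + k ^ 2 * C₁) * (N : ℝ) ^ 2 * 1 ≤
          (1 + k ^ 2 * C₁) * N ^ 2 * ((b ^ (2 * m))⁻¹ * tr ω) := by gcongr
      linarith
  have herrint : ∀ j l, Integrable (fun ω => entryError s e T (symMatrix X ω) j l) (P N) :=
    fun j l => hint fun Q => entryError s e T Q j l
  have herrle : ∀ j l, ∫ ω, entryError s e T (symMatrix X ω) j l ∂(P N) ≤ D * (√(ε N) + s⁻¹) := by
    intro j l
    have h1 := hX.integral_entryError_le hN hK1 hM1 (by rw [← hs]; exact hs1) hedel j l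
      fun n => hint fun Q => (e j ⬝ᵥ (Q ^ (n + 1)) *ᵥ e l -
        ∫ ω', e j ⬝ᵥ (symMatrix X ω' ^ (n + 1)) *ᵥ e l ∂(P N)) ^ 2
    rw [← hs, ← hD] at h1
    exact h1
  have hint1 : Integrable (fun ω => C * (s⁻¹ + ∑ j, ∑ l, entryError s e T (symMatrix X ω) j l))
      (P N) := hint fun Q => C * (s⁻¹ + ∑ j, ∑ l, entryError s e T Q j l)
  have hint2 : Integrable (fun ω => (1 + k ^ 2 * C₁) * N ^ 2 * ((b ^ (2 * m))⁻¹ * tr ω)) (P N) :=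
    hint fun Q => (1 + k ^ 2 * C₁) * N ^ 2 * ((b ^ (2 * m))⁻¹ * (Q ^ (2 * m)).trace)
  have hkey : |∫ ω, eig (A N ω) i ∂(P N) - eig B i| ≤
      C * (s⁻¹ + k ^ 2 * (D * (√(ε N) + s⁻¹))) + (1 + k ^ 2 * C₁) * E * s⁻¹ := by
    have h1 : ∫ ω, eig (A N ω) i ∂(P N) - eig B i = ∫ ω, (eig (A N ω) i - eig B i) ∂(P N) := by
      rw [integral_sub (hAN.integrable_comp fun Q => eig Q i) (integrable_const _), integral_const]
      simp
    rw [h1]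
    refine abs_integral_le_integral_abs.trans ?_
    refine (integral_mono_of_nonneg (Eventually.of_forall fun ω => abs_nonneg _)
      (hint1.add hint2) hpt).trans ?_
    rw [integral_add' hint1 hint2, integral_const_mul, integral_const_mul, integral_const_mul,
      integral_add (integrable_const _) (integrable_finsetSum _ fun j _ =>
        integrable_finsetSum _ fun l _ => herrint j l),
      integral_finsetSum _ fun j _ => integrable_finsetSum _ fun l _ => herrint j l, integral_const]
    simp only [probReal_univ, one_smul]
    refine add_le_add (mul_le_mul_of_nonneg_left (add_le_add le_rfl ?_) hC) ?_
    · calc _ ≤ ∑ j : Fin k, ∑ l : Fin k, D * (√(ε N) + s⁻¹) := by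
            refine Finset.sum_le_sum fun j _ => ?_
            rw [integral_finsetSum _ fun l _ => herrint j l]
            exact Finset.sum_le_sum fun l _ => herrle j l
        _ = _ := by simp; ring
    -- The factor N² meets the N⁻³ of the trace bound, and 1/N = ε_N/s ≤ E/s.
    · calc (1 + k ^ 2 * C₁) * (N : ℝ) ^ 2 * ((b ^ (2 * m))⁻¹ * ∫ ω, tr ω ∂(P N)) ≤
            (1 + k ^ 2 * C₁) * N ^ 2 * ((b ^ (2 * m))⁻¹ * (b ^ (2 * m) * (N : ℝ)⁻¹ ^ 3)) := by
            gcongr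
        _ = (1 + k ^ 2 * C₁) * (N : ℝ)⁻¹ := by field_simp
        _ = (1 + k ^ 2 * C₁) * ε N * s⁻¹ := by
            rw [hs]
            field_simp
        _ ≤ _ := by gcongr
  rw [← hs, Real.norm_eq_abs, Real.norm_of_nonneg (by positivity)]
  refine hkey.trans ?_
  have hq := Real.sqrt_nonneg (ε N)
  have hsi : 0 ≤ s⁻¹ := (inv_pos.2 hs0).le
  have g1 : 0 ≤ C * √(ε N) := by positivity
  have g2 : 0 ≤ (1 + k ^ 2 * C₁) * E * √(ε N) := by positivity
  linarith
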